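/- Let $M$ be a smooth manifold and $\mathfrak X(M)$ its vector fields. **Lie 2-algebroids.** A (split) Lie 2-algebroid $(A_{-1}\oplus A_0;\rho,l_1,l_2,l_3)$ over $M$ consists of smooth vector bundles $A_{-1},A_0$ of finite rank, a bundle map $\rho:A_0\to TM$, and $\mathbb R$-multilinear graded skew-symmetric brackets $l_1:\Gamma(A_{-1})\to\Gamma(A_0)$, $l_2:\Gamma(A_0)\times\Gamma(A_i)\to\Gamma(A_i)$ ($i=0,-1$; $l_2(m,x)=-l_2(x,m)$), $l_3:\wedge^3\Gamma(A_0)\to\Gamma(A_{-1})$ that make $\Gamma(A_{-1})\oplus\Gamma(A_0)$ a Lie 2-algebra (2-term $L_\infty$-algebra): $$l_1l_2(x,m)=l_2(x,l_1m),\qquad l_2(l_1m,n)=l_2(m,l_1n),$$ $$l_1l_3(x,y,z)=l_2(x,l_2(y,z))-l_2(l_2(x,y),z)-l_2(y,l_2(x,z)),$$ $$l_3(x,y,l_1m)=l_2(x,l_2(y,m))-l_2(l_2(x,y),m)-l_2(y,l_2(x,m)),$$ $$\sum_{i=1}^4(-1)^{i+1}l_2(x_i,l_3(x_1,..,\widehat{x_i},..,x_4))+\sum_{i<j}(-1)^{i+j}l_3(l_2(x_i,x_j),x_1,..,\widehat{x_i},..,\widehat{x_j},..,x_4)=0,$$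 such that $l_1,l_3$ are $C^\infty(M)$-multilinear, $l_2(x,fy)=f\,l_2(x,y)+\rho(x)(f)\,y$ and $l_2(x,fm)=f\,l_2(x,m)+\rho(x)(f)\,m$, and $l_2(fx,m)=f\,l_2(x,m)$, for $x,y,z,x_i\in\Gamma(A_0)$, $m,n\in\Gamma(A_{-1})$, $f\in C^\infty(M)$. It is *transitive* if $\rho$ is (fibrewise) surjective. If $\rho=0$ it is a *graded bundle of Lie 2-algebras*. For a transitive Lie 2-algebroid, restriction of the brackets makes $\mathfrak G=(A_{-1}\oplus\mathcal G;\mathfrak l_1,\mathfrak l_2,\mathfrak l_3)$, $\mathcal G=\ker\rho$, a graded bundle of Lie 2-algebras. A *splitting* is a pair of bundle maps $\sigma:TM\to A_0$ with $\rho\sigma=\mathrm{id}$ and $\gamma:\wedge^2TM\to A_{-1}$. It defines, for $X,Y,Z\in\mathfrak X(M)$, $u,v\in\Gamma(\mathcal G)$, $m\in\Gamma(A_{-1})$, $$\nabla^0_Xu=l_2(\sigma X,u),\quad \nabla^1_Xm=l_2(\sigma X,m),\quad R(X,Y)=\sigma[X,Y]-l_2(\sigma X,\sigma Y)-l_1\gamma(X,Y),$$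 $$I(X,Y,Z)=-d_{\nabla^1}\gamma(X,Y,Z)-l_3(\sigma X,\sigma Y,\sigma Z),\quad J(X,Y,u)=-l_3(\sigma X,\sigma Y,u),\quad K(X,u,v)=l_3(\sigma X,u,v),$$ $$R_\gamma=R+l_1\circ\gamma,\qquad I_\gamma=I+d_{\nabla^1}\gamma ,$$ where $d_{\nabla^1}\gamma(X,Y,Z)=\nabla^1_X\gamma(Y,Z)-\nabla^1_Y\gamma(X,Z)+\nabla^1_Z\gamma(X,Y)-\gamma([X,Y],Z)+\gamma([X,Z],Y)-\gamma([Y,Z],X)$. **The strict Lie 3-algebroid $\mathrm{DER}(\mathfrak G)$.** Let $\mathfrak G=(\mathcal G_{-1}\oplus\mathcal G_0;\mathfrak l_1,\mathfrak l_2,\mathfrak l_3)$ be a graded bundle of Lie 2-algebras. A degree-$0$ derivation is a triple $\mathfrak d=(\mathfrak d_0,\mathfrak d_1,l_{\mathfrak d})$ of covariant differential operators $\mathfrak d_0$ on $\mathcal G_0$ and $\mathfrak d_1$ on $\mathcal G_{-1}$ with the same symbol $\mathbb j(\mathfrak d)\in\mathfrak X(M)$ and $l_{\mathfrak d}\in\Gamma(\mathrm{Hom}(\wedge^2\mathcal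 G_0,\mathcal G_{-1}))$ such that $\mathfrak d_0\mathfrak l_1=\mathfrak l_1\mathfrak d_1$, $$\mathfrak d_0\mathfrak l_2(u,v)=\mathfrak l_2(\mathfrak d_0u,v)+\mathfrak l_2(u,\mathfrak d_0v)+\mathfrak l_1l_{\mathfrak d}(u,v),\quad \mathfrak d_1\mathfrak l_2(u,m)=\mathfrak l_2(\mathfrak d_0u,m)+\mathfrak l_2(u,\mathfrak d_1m)+l_{\mathfrak d}(u,\mathfrak l_1m),$$ $$l_{\mathfrak d}(u,\mathfrak l_2(v,w))+\mathfrak l_2(u,l_{\mathfrak d}(v,w))+\mathfrak l_3(\mathfrak d_0u,v,w)+\mathfrak l_3(u,\mathfrak d_0v,w)+\mathfrak l_3(u,v,\mathfrak d_0w)$$ $$=\mathfrak d_1\mathfrak l_3(u,v,w)+l_{\mathfrak d}(\mathfrak l_2(u,v),w)+l_{\mathfrak d}(v,\mathfrak l_2(u,w))+\mathfrak l_2(l_{\mathfrak d}(u,v),w)+\mathfrak l_2(v,l_{\mathfrak d}(u,w)).$$ They are the sections of $\mathrm{DER}^0(\mathfrak G)$; put $\mathrm{DER}^{-1}(\mathfrak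 G)=\mathrm{Hom}(\mathcal G_0,\mathcal G_{-1})\oplus\mathcal G_0$ and $\mathrm{DER}^{-2}(\mathfrak G)=\mathcal G_{-1}$. With the anchor $\mathbb j$, the differential $$\mathrm d(m)=-\mathfrak l_2(m,\cdot)+\mathfrak l_1(m),\qquad \mathrm d(\phi+u)=(\mathfrak l_1\phi,\ \phi\,\mathfrak l_1,\ l_{\delta(\phi)})+(\mathfrak l_2(u,\cdot),\ \mathfrak l_2(u,\cdot),\ \mathfrak l_3(u,\cdot,\cdot)),$$ $l_{\delta(\phi)}(u,v)=\phi(\mathfrak l_2(u,v))-\mathfrak l_2(\phi(u),v)-\mathfrak l_2(u,\phi(v))$, and the graded skew-symmetric brackets $$[\mathfrak d,\mathfrak t]=([\mathfrak d_0,\mathfrak t_0],[\mathfrak d_1,\mathfrak t_1],l_{[\mathfrak d,\mathfrak t]}),\quad [\mathfrak d,\phi+u]=\mathfrak d_1\phi-\phi\,\mathfrak d_0+l_{\mathfrak d}(u,\cdot)+\mathfrak d_0u,\quad[\mathfrak d,m]=\mathfrak d_1m,\quad[\phi+u,\psi+v]=\phi(v)+\psi(u),$$ $l_{[\mathfrak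 d,\mathfrak t]}(u,v)=\mathfrak d_1l_{\mathfrak t}(u,v)-l_{\mathfrak t}(\mathfrak d_0u,v)-l_{\mathfrak t}(u,\mathfrak d_0v)+l_{\mathfrak d}(\mathfrak t_0u,v)+l_{\mathfrak d}(u,\mathfrak t_0v)-\mathfrak t_1l_{\mathfrak d}(u,v)$, it is a strict Lie 3-algebroid (a Lie 3-algebroid whose brackets $l_i$ vanish for $i>2$). **Morphisms.** A morphism from $TM$ to $\mathrm{DER}(\mathfrak G)$ consists of bundle maps $F^i:\wedge^iTM\to\mathrm{DER}^{1-i}(\mathfrak G)$, $i=1,2,3$, such that $\mathbb j F^1(X)=X$, $F^1([X,Y])-[F^1X,F^1Y]=\mathrm dF^2(X,Y)$, $[F^1X,F^2(Y,Z)]-F^2([X,Y],Z)+\text{cyclic permutations}=\mathrm dF^3(X,Y,Z)$, and $$\sum_{i=1}^4(-1)^{i+1}[F^1X_i,F^3(X_1,..,\widehat{X_i},..,X_4)]+\sum_{i<j}(-1)^{i+j}\Big(F^3([X_i,X_j],X_k,X_l)-\tfrac12[F^2(X_i,X_j),F^2(X_k,X_l)]\Big)=0,$$ where $k<l$ and $\{i,j,k,l\}=\{1,2,3,4\}$.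 **Theorem.** (1) Let $(A_{-1}\oplus A_0;\rho,l_1,l_2,l_3)$ be a transitive Lie 2-algebroid with a splitting $(\sigma,\gamma)$, and let $\mathfrak G=(A_{-1}\oplus\ker\rho;\mathfrak l_1,\mathfrak l_2,\mathfrak l_3)$. Then $$F^1(X)=(\nabla^0_X,\nabla^1_X,K(X,\cdot,\cdot)),\qquad F^2(X,Y)=J(X,Y,\cdot)+R_\gamma(X,Y),\qquad F^3=I_\gamma$$ is a morphism from the tangent Lie algebroid $TM$ to the strict Lie 3-algebroid $\mathrm{DER}(\mathfrak G)$. Moreover, $\mathfrak G$ and $(F^1,F^2,F^3)$ determine the Lie 2-algebroid: $(X,u)\mapsto\sigma(X)+u$ and $\mathrm{id}_{A_{-1}}$ form a strict isomorphism (bundle isomorphisms preserving the anchor and all brackets) onto it from the Lie 2-algebroid $A_{-1}\oplus(TM\oplus\ker\rho)$ with $\rho=\mathrm{pr}_{TM}$ and $$l_1(m)=\mathfrak l_1(m),\quad l_2(X+u,m)=\nabla^1_Xm+\mathfrak l_2(u,m),\quad l_2(X+u,Y+v)=[X,Y]-R_\gamma(X,Y)+\nabla^0_Xv-\nabla^0_Yu+\mathfrak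 l_2(u,v),$$ $$l_3(X+u,Y+v,Z+w)=-I_\gamma(X,Y,Z)-J(X,Y,w)+J(X,Z,v)-J(Y,Z,u)+K(X,v,w)-K(Y,u,w)+K(Z,u,v)+\mathfrak l_3(u,v,w).$$ (2) Conversely, let $\mathfrak G=(\mathcal G_{-1}\oplus\mathcal G_0;\mathfrak l_1,\mathfrak l_2,\mathfrak l_3)$ be a graded bundle of Lie 2-algebras and $F=(F^1,F^2,F^3)$ any morphism from $TM$ to $\mathrm{DER}(\mathfrak G)$. Write $F^1(X)=(\nabla^0_X,\nabla^1_X,K(X,\cdot,\cdot))$, $F^2(X,Y)=J(X,Y,\cdot)+R_\gamma(X,Y)$, $F^3=I_\gamma$. Then the formulas in (1), with $\rho=\mathrm{pr}_{TM}$, define a transitive Lie 2-algebroid $\mathcal G_{-1}\oplus(TM\oplus\mathcal G_0)$. -/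

import Mathlib

open scoped Manifold ContDiff Bundle

set_option linter.unusedSectionVars false

noncomputable section

/-- `C^∞(M)`, the algebra of smooth functions on a manifold `M` modelled on `E`. -/
abbrev Fn (E M : Type*) [NormedAddCommGroup E] [NormedSpace ℝ E] [TopologicalSpace M]
    [ChartedSpace E M] : Type _ :=
  C^∞⟮𝓘(ℝ, E), M; ℝ⟯

/-- `Γ(V)`, the smooth global sections of a vector bundle `V` with typical fibre `F`. -/
abbrev Sec (E : Type*) {M : Type*} [NormedAddCommGroup E] [NormedSpace ℝ E] [TopologicalSpace M]
    [ChartedSpace E M] (F : Type*) [NormedAddCommGroup F] [NormedSpace ℝ F] (V : M → Type*)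
    [TopologicalSpace (Bundle.TotalSpace F V)] [∀ x, TopologicalSpace (V x)]
    [FiberBundle F V] : Type _ :=
  Cₛ^∞⟮𝓘(ℝ, E); F, V⟯

/-- `𝔛(M)`, the smooth vector fields on `M`. -/
abbrev VF (E M : Type*) [NormedAddCommGroup E] [NormedSpace ℝ E] [TopologicalSpace M]
    [ChartedSpace E M] [IsManifold 𝓘(ℝ, E) ∞ M] : Type _ :=
  Sec E E (TangentSpace 𝓘(ℝ, E) : M → Type _)

section Sections

variable {E M : Type*} [NormedAddCommGroup E] [NormedSpace ℝ E] [TopologicalSpace M]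
  [ChartedSpace E M] {F : Type*} [NormedAddCommGroup F] [NormedSpace ℝ F] {V : M → Type*}
  [∀ x, AddCommGroup (V x)] [∀ x, Module ℝ (V x)]
  [TopologicalSpace (Bundle.TotalSpace F V)] [∀ x, TopologicalSpace (V x)]
  [FiberBundle F V] [VectorBundle ℝ F V]

instance secSMul : SMul (Fn E M) (Sec E F V) :=
  ⟨fun f s => ⟨(f : M → ℝ) • (s : ∀ x, V x), f.contMDiff.smul_section s.contMDiff⟩⟩

theorem sec_smul_apply (f : Fn E M) (s : Sec E F V) (x : M) : (f • s) x = f x • s x := rfl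

instance secModule : Module (Fn E M) (Sec E F V) where
  one_smul s := by ext x; exact one_smul ℝ (s x)
  mul_smul f g s := by ext x; exact mul_smul (f x) (g x) (s x)
  smul_zero f := by ext x; exact smul_zero (f x)
  smul_add f s t := by ext x; exact smul_add (f x) (s x) (t x)
  add_smul f g s := by ext x; exact add_smul (f x) (g x) (s x)
  zero_smul s := by ext x; exact zero_smul ℝ (s x)

instance secTower : IsScalarTower ℝ (Fn E M) (Sec E F V) where
  smul_assoc c f s := by ext x; exact mul_smul c (f x) (s x)

end Sections

section VectorFields

variable {E M : Type*} [NormedAddCommGroup E] [NormedSpace ℝ E] [FiniteDimensional ℝ E]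
  [TopologicalSpace M] [ChartedSpace E M] [IsManifold 𝓘(ℝ, E) ∞ M]

theorem vf_act_smooth (X : VF E M) (f : Fn E M) :
    ContMDiff 𝓘(ℝ, E) 𝓘(ℝ, ℝ) ∞ (fun x => mvfderiv 𝓘(ℝ, E) f x (X x)) := by
  have h1 := (f.contMDiff.contMDiff_tangentMap (m := ∞) (by simp)).comp X.contMDiff
  intro x
  have h2 := h1 x
  rw [Function.comp_def, Bundle.contMDiffAt_totalSpace] at h2
  refine h2.2.congr_of_eventuallyEq (Filter.Eventually.of_forall fun y => ?_)
  simp [tangentMap, mvfderiv]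
  rfl

/-- The Lie bracket of smooth vector fields. -/
instance vfBracket : Bracket (VF E M) (VF E M) :=
  ⟨fun X Y => ⟨VectorField.mlieBracket 𝓘(ℝ, E) X Y, by
    have : CompleteSpace E := FiniteDimensional.complete ℝ E
    have : IsManifold 𝓘(ℝ, E) ((∞ : WithTop ℕ∞) + 1) M := by simpa using (inferInstance : IsManifold 𝓘(ℝ, E) ∞ M)
    have : IsManifold 𝓘(ℝ, E) (minSmoothness ℝ 2) M := by simpa using (inferInstance : IsManifold 𝓘(ℝ, E) 2 M)
    intro x
    exact ContMDiffAt.mlieBracket_vectorField (m := (⊤ : ℕ∞)) (n := (⊤ : ℕ∞)) (X.contMDiff x) (Y.contMDiff x) (by simp)⟩⟩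

theorem vf_bracket_apply (X Y : VF E M) (x : M) :
    ⁅X, Y⁆ x = VectorField.mlieBracket 𝓘(ℝ, E) X Y x := rfl

instance vfLieRing : LieRing (VF E M) where
  add_lie X Y Z := by
    ext x
    have : CompleteSpace E := FiniteDimensional.complete ℝ E
    exact VectorField.mlieBracket_add_left X.mdifferentiableAt Y.mdifferentiableAt
  lie_add X Y Z := by
    ext x
    have : CompleteSpace E := FiniteDimensional.complete ℝ E
    exact VectorField.mlieBracket_add_right Y.mdifferentiableAt Z.mdifferentiableAt
  lie_self X := by
    ext x
    rw [vf_bracket_apply, VectorField.mlieBracket_self]; rfl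
  leibniz_lie X Y Z := by
    have : CompleteSpace E := FiniteDimensional.complete ℝ E
    have : IsManifold 𝓘(ℝ, E) (minSmoothness ℝ 3) M := by simpa using (inferInstance : IsManifold 𝓘(ℝ, E) 3 M)
    have h : ∀ X : VF E M, ContMDiff 𝓘(ℝ, E) (𝓘(ℝ, E).prod 𝓘(ℝ, E)) (minSmoothness ℝ 2)
      (fun x => (⟨x, X x⟩ : Bundle.TotalSpace E (TangentSpace 𝓘(ℝ, E) : M → Type _))) := fun X =>
        X.contMDiff.of_le (by simpa using WithTop.coe_le_coe.2 (le_top : (2 : ℕ∞) ≤ ⊤))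
    ext x
    exact VectorField.leibniz_identity_mlieBracket_apply (h X x) (h Y x) (h Z x)

/-- The action `X ↦ (f ↦ X(f))` of vector fields on smooth functions. -/
def vfDer : VF E M →ₗ[Fn E M] Derivation ℝ (Fn E M) (Fn E M) where
  toFun X := Derivation.mk'
    { toFun := fun f => ⟨fun x => mvfderiv 𝓘(ℝ, E) f x (X x), vf_act_smooth X f⟩
      map_add' := fun f g => by
        ext x
        exact congrArg (fun L => L (X x)) (mvfderiv_add f.mdifferentiableAt g.mdifferentiableAt)
      map_smul' := fun c f => by
        ext x
        have := congrArg (fun L => L (X x))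
          (mvfderiv_smul (I := 𝓘(ℝ, E)) (a := fun _ : M => c) mdifferentiableAt_const
            (g := f) (x := x) f.mdifferentiableAt)
        simp only [mvfderiv_const] at this
        refine Eq.trans this ?_
        change c * mvfderiv 𝓘(ℝ, E) f x (X x) + 0 * f x = c * mvfderiv 𝓘(ℝ, E) f x (X x)
        ring }
    (fun f g => by
      ext x
      exact congrArg (fun L => L (X x)) (mvfderiv_mul (I := 𝓘(ℝ, E)) (f := f) (g := g) (x := x)
        f.mdifferentiableAt g.mdifferentiableAt))
  map_add' X Y := by ext f x; exact map_add (mvfderiv 𝓘(ℝ, E) f x) (X x) (Y x)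
  map_smul' g X := by ext f x; exact map_smul (mvfderiv 𝓘(ℝ, E) f x) (g x) (X x)

theorem vfDer_apply (X : VF E M) (f : Fn E M) (x : M) :
    vfDer X f x = mvfderiv 𝓘(ℝ, E) f x (X x) := rfl

theorem vf_lie_smul (X Y : VF E M) (f : Fn E M) : ⁅X, f • Y⁆ = f • ⁅X, Y⁆ + vfDer X f • Y := by
  have : CompleteSpace E := FiniteDimensional.complete ℝ E
  ext x
  exact (VectorField.mlieBracket_smul_right (V := X) (W := Y) (f := f) f.mdifferentiableAt Y.mdifferentiableAt).trans (add_comm _ _)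

instance vfLieAlgebra : LieAlgebra ℝ (VF E M) where
  lie_smul c X Y := by
    have : CompleteSpace E := FiniteDimensional.complete ℝ E
    ext x
    exact VectorField.mlieBracket_const_smul_right (V := X) (W := Y) (c := c) Y.mdifferentiableAt

theorem vfDer_lie (X Y : VF E M) (f : Fn E M) :
    vfDer ⁅X, Y⁆ f = vfDer X (vfDer Y f) - vfDer Y (vfDer X f) := by
  -- the difference of the two sides annihilates every vector field
  have key : ∀ Z : VF E M,
      (vfDer ⁅X, Y⁆ f - (vfDer X (vfDer Y f) - vfDer Y (vfDer X f))) • Z = 0 := by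
    intro Z
    have h := leibniz_lie X Y (f • Z)
    simp only [vf_lie_smul, lie_add] at h
    rw [leibniz_lie X Y Z] at h
    simp only [sub_smul, smul_add] at h ⊢
    rw [← sub_eq_zero] at h
    rw [← neg_eq_zero, ← h]
    abel
  ext x
  by_contra hne
  have h0 : (vfDer ⁅X, Y⁆ f - (vfDer X (vfDer Y f) - vfDer Y (vfDer X f))) x ≠ 0 := by
    intro h; exact hne (sub_eq_zero.mp h)
  have hz : ∀ Z : VF E M, Z x = 0 := by
    intro Z
    have := congrArg (fun W : VF E M => W x) (key Z)
    exact (smul_eq_zero.mp this).resolve_left h0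
  apply hne
  have e : ∀ (Z : VF E M) (g : Fn E M), vfDer Z g x = 0 := by
    intro Z g; rw [vfDer_apply, hz Z, map_zero]
  change vfDer ⁅X, Y⁆ f x = vfDer X (vfDer Y f) x - vfDer Y (vfDer X f) x
  rw [e, e, e, sub_zero]

theorem vf_eq_zero [T2Space M] (X : VF E M) (h : ∀ f : Fn E M, vfDer X f = 0) : X = 0 := by
  ext x
  obtain ⟨b⟩ : Nonempty (SmoothBumpFunction 𝓘(ℝ, E) x) := inferInstance
  by_contra hne
  obtain ⟨l, hl⟩ : ∃ l : E →L[ℝ] ℝ, l (X x) ≠ 0 := by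
    by_contra! hall
    exact hne ((SeparatingDual.eq_zero_iff_forall_dual_eq_zero (R := ℝ) (V := E) (X x)).2 hall)
  have hs : ContMDiff 𝓘(ℝ, E) 𝓘(ℝ, ℝ) ∞ (fun y => b y • l (extChartAt 𝓘(ℝ, E) x y)) := by
    apply b.contMDiff_smul
    have := contMDiffOn_extChartAt (I := 𝓘(ℝ, E)) (n := ∞) (x := x)
    exact l.contMDiff.comp_contMDiffOn this
  have h1 := congrArg (fun g : Fn E M => g x) (h ⟨_, hs⟩)
  have h2 : mvfderiv 𝓘(ℝ, E) (fun y => b y • l (extChartAt 𝓘(ℝ, E) x y)) x (X x) = 0 := h1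
  have h3 : (fun y => b y • l (extChartAt 𝓘(ℝ, E) x y)) =ᶠ[nhds x]
      fun y => l (extChartAt 𝓘(ℝ, E) x y) := by
    filter_upwards [b.eventuallyEq_one] with y hy
    rw [hy]; simp
  have hd : MDifferentiableAt 𝓘(ℝ, E) 𝓘(ℝ, E) (extChartAt 𝓘(ℝ, E) x) x :=
    mdifferentiableAt_extChartAt (mem_chart_source E x)
  rw [mvfderiv, h3.mfderiv_eq] at h2
  have h4 : mfderiv 𝓘(ℝ, E) 𝓘(ℝ, ℝ) (fun y => l (extChartAt 𝓘(ℝ, E) x y)) x =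
      (mfderiv 𝓘(ℝ, E) 𝓘(ℝ, ℝ) l (extChartAt 𝓘(ℝ, E) x x)).comp
        (mfderiv 𝓘(ℝ, E) 𝓘(ℝ, E) (extChartAt 𝓘(ℝ, E) x) x) :=
    mfderiv_comp x l.differentiableAt.mdifferentiableAt hd
  rw [h4, mfderiv_extChartAt_self] at h2
  apply hl
  rw [mfderiv_eq_fderiv, l.fderiv] at h2
  exact h2

end VectorFields

section Algebra

/-- A Lie 2-algebra (2-term `L_∞`-algebra) `V1 → V0`.  The bracket `l2 : V1 × V0 → V1` is
determined by skew-symmetry, `l2 (m, x) = - l2 (x, m)`; here `l2' x m` denotes `l2 (x, m)`. -/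
structure Lie2Algebra (V0 V1 : Type*) [AddCommGroup V0] [Module ℝ V0] [AddCommGroup V1]
    [Module ℝ V1] where
  l1 : V1 →ₗ[ℝ] V0
  l2 : V0 →ₗ[ℝ] V0 →ₗ[ℝ] V0
  l2' : V0 →ₗ[ℝ] V1 →ₗ[ℝ] V1
  l3 : V0 →ₗ[ℝ] V0 →ₗ[ℝ] V0 →ₗ[ℝ] V1
  l2_skew : ∀ x y, l2 x y = -l2 y x
  l3_skew_left : ∀ x y z, l3 x y z = -l3 y x z
  l3_skew_right : ∀ x y z, l3 x y z = -l3 x z y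
  l1_l2' : ∀ x m, l1 (l2' x m) = l2 x (l1 m)
  l2'_l1 : ∀ m n, l2' (l1 m) n = -l2' (l1 n) m
  jacobi : ∀ x y z, l1 (l3 x y z) = l2 x (l2 y z) - l2 (l2 x y) z - l2 y (l2 x z)
  jacobi' : ∀ x y m, l3 x y (l1 m) = l2' x (l2' y m) - l2' (l2 x y) m - l2' y (l2' x m)
  jacobiator : ∀ w x y z,
    l2' w (l3 x y z) - l2' x (l3 w y z) + l2' y (l3 w x z) - l2' z (l3 w x y)
      - l3 (l2 w x) y z - l3 x (l2 w y) z - l3 x y (l2 w z)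
      + l3 w (l2 x y) z + l3 w y (l2 x z) - l3 w x (l2 y z) = 0

variable (E M : Type*) [NormedAddCommGroup E] [NormedSpace ℝ E] [FiniteDimensional ℝ E]
  [TopologicalSpace M] [ChartedSpace E M] [IsManifold 𝓘(ℝ, E) ∞ M]

/-- A Lie algebroid over `M`, described on its `C^∞(M)`-module `L` of sections. -/
structure LieAlgebroid (L : Type*) [AddCommGroup L] [Module ℝ L] [Module (Fn E M) L]
    [IsScalarTower ℝ (Fn E M) L] where
  anchor : L →ₗ[Fn E M] VF E M
  bracket : L →ₗ[ℝ] L →ₗ[ℝ] L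
  skew : ∀ x y, bracket x y = -bracket y x
  jacobi : ∀ x y z, bracket x (bracket y z) = bracket (bracket x y) z + bracket y (bracket x z)
  leibniz : ∀ x (f : Fn E M) y,
    bracket x (f • y) = f • bracket x y + vfDer (anchor x) f • y

/-- A split Lie 2-algebroid over `M`, described on the `C^∞(M)`-modules `L0 = Γ(A_0)` and
`L1 = Γ(A_{-1})` of sections. -/
structure Lie2Algebroid (L0 L1 : Type*)
    [AddCommGroup L0] [Module ℝ L0] [Module (Fn E M) L0] [IsScalarTower ℝ (Fn E M) L0]
    [AddCommGroup L1] [Module ℝ L1] [Module (Fn E M) L1] [IsScalarTower ℝ (Fn E M) L1]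
    extends Lie2Algebra L0 L1 where
  anchor : L0 →ₗ[Fn E M] VF E M
  l1_smul : ∀ (f : Fn E M) m, l1 (f • m) = f • l1 m
  l2_leibniz : ∀ x (f : Fn E M) y, l2 x (f • y) = f • l2 x y + vfDer (anchor x) f • y
  l2'_leibniz : ∀ x (f : Fn E M) m, l2' x (f • m) = f • l2' x m + vfDer (anchor x) f • m
  l2'_smul : ∀ (f : Fn E M) x m, l2' (f • x) m = f • l2' x m
  l3_smul : ∀ x y (f : Fn E M) z, l3 x y (f • z) = f • l3 x y z

/-- A graded bundle of Lie 2-algebras over `M`, described on the `C^∞(M)`-modules `G0 = Γ(𝒢_0)`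
and `G1 = Γ(𝒢_{-1})` of sections: all brackets are `C^∞(M)`-multilinear. -/
structure Lie2AlgebraBundle (G0 G1 : Type*)
    [AddCommGroup G0] [Module ℝ G0] [Module (Fn E M) G0] [IsScalarTower ℝ (Fn E M) G0]
    [AddCommGroup G1] [Module ℝ G1] [Module (Fn E M) G1] [IsScalarTower ℝ (Fn E M) G1]
    extends Lie2Algebra G0 G1 where
  l1_smul : ∀ (f : Fn E M) m, l1 (f • m) = f • l1 m
  l2_smul : ∀ u (f : Fn E M) v, l2 u (f • v) = f • l2 u v
  l2'_smul_right : ∀ u (f : Fn E M) m, l2' u (f • m) = f • l2' u m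
  l2'_smul_left : ∀ (f : Fn E M) u m, l2' (f • u) m = f • l2' u m
  l3_smul : ∀ u v (f : Fn E M) w, l3 u v (f • w) = f • l3 u v w

/-- A strict Lie 3-algebroid over `M`, described on the `C^∞(M)`-modules `D0`, `D1`, `D2` of
sections in degrees `0`, `-1`, `-2`.  The brackets in the remaining order of the degrees are
determined by graded skew-symmetry, and all other brackets vanish for degree reasons. -/
structure StrictLie3Algebroid (D0 D1 D2 : Type*)
    [AddCommGroup D0] [Module ℝ D0] [Module (Fn E M) D0] [IsScalarTower ℝ (Fn E M) D0]
    [AddCommGroup D1] [Module ℝ D1] [Module (Fn E M) D1] [IsScalarTower ℝ (Fn E M) D1]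
    [AddCommGroup D2] [Module ℝ D2] [Module (Fn E M) D2] [IsScalarTower ℝ (Fn E M) D2] where
  anchor : D0 →ₗ[Fn E M] VF E M
  /-- `l_1` from degree `-1` to degree `0` -/
  d1 : D1 →ₗ[Fn E M] D0
  /-- `l_1` from degree `-2` to degree `-1` -/
  d2 : D2 →ₗ[Fn E M] D1
  /-- `l_2` on degrees `(0, 0)` -/
  b00 : D0 →ₗ[ℝ] D0 →ₗ[ℝ] D0
  /-- `l_2` on degrees `(0, -1)` -/
  b01 : D0 →ₗ[ℝ] D1 →ₗ[ℝ] D1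
  /-- `l_2` on degrees `(0, -2)` -/
  b02 : D0 →ₗ[ℝ] D2 →ₗ[ℝ] D2
  /-- `l_2` on degrees `(-1, -1)` -/
  b11 : D1 →ₗ[ℝ] D1 →ₗ[ℝ] D2
  b00_skew : ∀ x y, b00 x y = -b00 y x
  b11_symm : ∀ a b, b11 a b = b11 b a
  d1_d2 : ∀ m, d1 (d2 m) = 0
  d1_b01 : ∀ x a, d1 (b01 x a) = b00 x (d1 a)
  d2_b02 : ∀ x m, d2 (b02 x m) = b01 x (d2 m)
  d2_b11 : ∀ a b, d2 (b11 a b) = b01 (d1 a) b + b01 (d1 b) a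
  b02_d1 : ∀ a m, b02 (d1 a) m = b11 a (d2 m)
  jacobi000 : ∀ x y z, b00 x (b00 y z) = b00 (b00 x y) z + b00 y (b00 x z)
  jacobi001 : ∀ x y a, b01 x (b01 y a) = b01 (b00 x y) a + b01 y (b01 x a)
  jacobi002 : ∀ x y m, b02 x (b02 y m) = b02 (b00 x y) m + b02 y (b02 x m)
  jacobi011 : ∀ x a b, b02 x (b11 a b) = b11 (b01 x a) b + b11 a (b01 x b)
  b00_leibniz : ∀ x (f : Fn E M) y, b00 x (f • y) = f • b00 x y + vfDer (anchor x) f • y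
  b01_leibniz : ∀ x (f : Fn E M) a, b01 x (f • a) = f • b01 x a + vfDer (anchor x) f • a
  b02_leibniz : ∀ x (f : Fn E M) m, b02 x (f • m) = f • b02 x m + vfDer (anchor x) f • m
  b01_smul : ∀ (f : Fn E M) x a, b01 (f • x) a = f • b01 x a
  b02_smul : ∀ (f : Fn E M) x m, b02 (f • x) m = f • b02 x m
  b11_smul : ∀ a (f : Fn E M) b, b11 a (f • b) = f • b11 a b

variable {E M}

/-- A morphism from a Lie algebroid to a strict Lie 3-algebroid; bundle maps are
`C^∞(M)`-linear maps on sections. -/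
structure LieAlgebroid.Morphism {L D0 D1 D2 : Type*}
    [AddCommGroup L] [Module ℝ L] [Module (Fn E M) L] [IsScalarTower ℝ (Fn E M) L]
    [AddCommGroup D0] [Module ℝ D0] [Module (Fn E M) D0] [IsScalarTower ℝ (Fn E M) D0]
    [AddCommGroup D1] [Module ℝ D1] [Module (Fn E M) D1] [IsScalarTower ℝ (Fn E M) D1]
    [AddCommGroup D2] [Module ℝ D2] [Module (Fn E M) D2] [IsScalarTower ℝ (Fn E M) D2]
    (A : LieAlgebroid E M L) (B : StrictLie3Algebroid E M D0 D1 D2) where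
  F1 : L →ₗ[Fn E M] D0
  F2 : L →ₗ[Fn E M] L →ₗ[Fn E M] D1
  F3 : L →ₗ[Fn E M] L →ₗ[Fn E M] L →ₗ[Fn E M] D2
  F2_skew : ∀ X Y, F2 X Y = -F2 Y X
  F3_skew_left : ∀ X Y Z, F3 X Y Z = -F3 Y X Z
  F3_skew_right : ∀ X Y Z, F3 X Y Z = -F3 X Z Y
  anchor_F1 : ∀ X, B.anchor (F1 X) = A.anchor X
  eq2 : ∀ X Y, F1 (A.bracket X Y) - B.b00 (F1 X) (F1 Y) = B.d1 (F2 X Y)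
  eq3 : ∀ X Y Z,
    (B.b01 (F1 X) (F2 Y Z) - F2 (A.bracket X Y) Z)
      + (B.b01 (F1 Y) (F2 Z X) - F2 (A.bracket Y Z) X)
      + (B.b01 (F1 Z) (F2 X Y) - F2 (A.bracket Z X) Y) = B.d2 (F3 X Y Z)
  eq4 : ∀ X₁ X₂ X₃ X₄,
    (B.b02 (F1 X₁) (F3 X₂ X₃ X₄) - B.b02 (F1 X₂) (F3 X₁ X₃ X₄)
      + B.b02 (F1 X₃) (F3 X₁ X₂ X₄) - B.b02 (F1 X₄) (F3 X₁ X₂ X₃))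
    + (-(F3 (A.bracket X₁ X₂) X₃ X₄ - (1 / 2 : ℝ) • B.b11 (F2 X₁ X₂) (F2 X₃ X₄))
      + (F3 (A.bracket X₁ X₃) X₂ X₄ - (1 / 2 : ℝ) • B.b11 (F2 X₁ X₃) (F2 X₂ X₄))
      - (F3 (A.bracket X₁ X₄) X₂ X₃ - (1 / 2 : ℝ) • B.b11 (F2 X₁ X₄) (F2 X₂ X₃))
      - (F3 (A.bracket X₂ X₃) X₁ X₄ - (1 / 2 : ℝ) • B.b11 (F2 X₂ X₃) (F2 X₁ X₄))
      + (F3 (A.bracket X₂ X₄) X₁ X₃ - (1 / 2 : ℝ) • B.b11 (F2 X₂ X₄) (F2 X₁ X₃))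
      - (F3 (A.bracket X₃ X₄) X₁ X₂ - (1 / 2 : ℝ) • B.b11 (F2 X₃ X₄) (F2 X₁ X₂))) = 0

variable (E M) in
/-- The tangent Lie algebroid `TM`. -/
def tangentLieAlgebroid : LieAlgebroid E M (VF E M) where
  anchor := LinearMap.id
  bracket := LinearMap.mk₂ ℝ (fun X Y => ⁅X, Y⁆) add_lie smul_lie lie_add lie_smul
  skew X Y := (lie_skew X Y).symm
  jacobi X Y Z := leibniz_lie X Y Z
  leibniz X f Y := vf_lie_smul X Y f

end Algebra

section Derivations

variable {E M : Type*} [NormedAddCommGroup E] [NormedSpace ℝ E] [FiniteDimensional ℝ E]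
  [TopologicalSpace M] [ChartedSpace E M] [IsManifold 𝓘(ℝ, E) ∞ M]

variable (E M) in
/-- `Γ(𝔇(𝒢))`, the covariant differential operators on `G = Γ(𝒢)`: pairs of a vector field (the
symbol) and an operator satisfying the Leibniz rule.  (The symbol is determined by the operator
unless `𝒢` has rank zero, where `𝔇(𝒢) = TM`.) -/
def CovDiffOp (G : Type*) [AddCommGroup G] [Module ℝ G] [Module (Fn E M) G]
    [IsScalarTower ℝ (Fn E M) G] : Submodule (Fn E M) (VF E M × (G →ₗ[ℝ] G)) where
  carrier := {p | ∀ (f : Fn E M) u, p.2 (f • u) = f • p.2 u + vfDer p.1 f • u}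
  add_mem' {p q} hp hq f u := by
    change p.2 (f • u) + q.2 (f • u) = f • (p.2 u + q.2 u) + vfDer (p.1 + q.1) f • u
    rw [hp f u, hq f u, map_add, Derivation.add_apply]
    module
  zero_mem' f u := by
    change 0 = f • 0 + vfDer 0 f • u
    rw [map_zero, Derivation.zero_apply]
    module
  smul_mem' g p hp f u := by
    change g • p.2 (f • u) = f • g • p.2 u + vfDer (g • p.1) f • u
    rw [hp f u, map_smul, Derivation.smul_apply, smul_eq_mul]
    module

variable {G0 G1 : Type*}
  [AddCommGroup G0] [Module ℝ G0] [Module (Fn E M) G0] [IsScalarTower ℝ (Fn E M) G0]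
  [AddCommGroup G1] [Module ℝ G1] [Module (Fn E M) G1] [IsScalarTower ℝ (Fn E M) G1]

namespace Lie2AlgebraBundle

variable (𝔊 : Lie2AlgebraBundle E M G0 G1)

/-- A triple `(𝔡_0, 𝔡_1, l_𝔡)` is a degree `0` derivation. -/
structure IsDer (D : CovDiffOp E M G0 × CovDiffOp E M G1 × (G0 →ₗ[Fn E M] G0 →ₗ[Fn E M] G1)) :
    Prop where
  symbol : D.1.1.1 = D.2.1.1.1
  skew : ∀ u v, D.2.2 u v = -D.2.2 v u
  comm_l1 : ∀ m, D.1.1.2 (𝔊.l1 m) = 𝔊.l1 (D.2.1.1.2 m)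
  der_l2 : ∀ u v, D.1.1.2 (𝔊.l2 u v) =
    𝔊.l2 (D.1.1.2 u) v + 𝔊.l2 u (D.1.1.2 v) + 𝔊.l1 (D.2.2 u v)
  der_l2' : ∀ u m, D.2.1.1.2 (𝔊.l2' u m) =
    𝔊.l2' (D.1.1.2 u) m + 𝔊.l2' u (D.2.1.1.2 m) + D.2.2 u (𝔊.l1 m)
  der_l3 : ∀ u v w,
    D.2.2 u (𝔊.l2 v w) + 𝔊.l2' u (D.2.2 v w)
      + 𝔊.l3 (D.1.1.2 u) v w + 𝔊.l3 u (D.1.1.2 v) w + 𝔊.l3 u v (D.1.1.2 w) =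
    D.2.1.1.2 (𝔊.l3 u v w) + D.2.2 (𝔊.l2 u v) w + D.2.2 v (𝔊.l2 u w)
      - 𝔊.l2' w (D.2.2 u v) + 𝔊.l2' v (D.2.2 u w)

theorem l2_smul_left (f : Fn E M) (u v : G0) : 𝔊.l2 (f • u) v = f • 𝔊.l2 u v := by
  rw [𝔊.l2_skew, 𝔊.l2_smul, 𝔊.l2_skew u v, smul_neg]

theorem l3_smul_mid (f : Fn E M) (u v w : G0) : 𝔊.l3 u (f • v) w = f • 𝔊.l3 u v w := by
  rw [𝔊.l3_skew_right, 𝔊.l3_smul, 𝔊.l3_skew_right u v w, smul_neg]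

theorem l3_smul_left (f : Fn E M) (u v w : G0) : 𝔊.l3 (f • u) v w = f • 𝔊.l3 u v w := by
  rw [𝔊.l3_skew_left, l3_smul_mid, 𝔊.l3_skew_left u v w, smul_neg]

/-- The degree `0` derivations of `𝔊` form a `C^∞(M)`-module. -/
def derSubmodule : Submodule (Fn E M)
    (CovDiffOp E M G0 × CovDiffOp E M G1 × (G0 →ₗ[Fn E M] G0 →ₗ[Fn E M] G1)) where
  carrier := {D | 𝔊.IsDer D}
  add_mem' {D T} hD hT :=
    { symbol := congrArg₂ (· + ·) hD.symbol hT.symbol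
      skew := fun u v => by
        change D.2.2 u v + T.2.2 u v = -(D.2.2 v u + T.2.2 v u)
        rw [hD.skew, hT.skew]; abel
      comm_l1 := fun m => by
        change D.1.1.2 (𝔊.l1 m) + T.1.1.2 (𝔊.l1 m) = 𝔊.l1 (D.2.1.1.2 m + T.2.1.1.2 m)
        rw [hD.comm_l1, hT.comm_l1, map_add]
      der_l2 := fun u v => by
        change D.1.1.2 (𝔊.l2 u v) + T.1.1.2 (𝔊.l2 u v) =
          𝔊.l2 (D.1.1.2 u + T.1.1.2 u) v + 𝔊.l2 u (D.1.1.2 v + T.1.1.2 v)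
            + 𝔊.l1 (D.2.2 u v + T.2.2 u v)
        rw [hD.der_l2, hT.der_l2]
        simp only [map_add, LinearMap.add_apply]
        abel
      der_l2' := fun u m => by
        change D.2.1.1.2 (𝔊.l2' u m) + T.2.1.1.2 (𝔊.l2' u m) =
          𝔊.l2' (D.1.1.2 u + T.1.1.2 u) m + 𝔊.l2' u (D.2.1.1.2 m + T.2.1.1.2 m)
            + (D.2.2 u (𝔊.l1 m) + T.2.2 u (𝔊.l1 m))
        rw [hD.der_l2', hT.der_l2']
        simp only [map_add, LinearMap.add_apply]
        abel
      der_l3 := fun u v w => by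
        have h1 := hD.der_l3 u v w
        have h2 := hT.der_l3 u v w
        change (D.2.2 u (𝔊.l2 v w) + T.2.2 u (𝔊.l2 v w)) + 𝔊.l2' u (D.2.2 v w + T.2.2 v w)
            + 𝔊.l3 (D.1.1.2 u + T.1.1.2 u) v w + 𝔊.l3 u (D.1.1.2 v + T.1.1.2 v) w
            + 𝔊.l3 u v (D.1.1.2 w + T.1.1.2 w) =
          (D.2.1.1.2 (𝔊.l3 u v w) + T.2.1.1.2 (𝔊.l3 u v w))
            + (D.2.2 (𝔊.l2 u v) w + T.2.2 (𝔊.l2 u v) w)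
            + (D.2.2 v (𝔊.l2 u w) + T.2.2 v (𝔊.l2 u w))
            - 𝔊.l2' w (D.2.2 u v + T.2.2 u v) + 𝔊.l2' v (D.2.2 u w + T.2.2 u w)
        simp only [map_add, LinearMap.add_apply]
        linear_combination (norm := module) h1 + h2 }
  zero_mem' :=
    { symbol := rfl
      skew := fun u v => by change (0 : G1) = -0; simp
      comm_l1 := fun m => by change (0 : G0) = 𝔊.l1 0; simp
      der_l2 := fun u v => by change (0 : G0) = 𝔊.l2 0 v + 𝔊.l2 u 0 + 𝔊.l1 0; simp
      der_l2' := fun u m => by change (0 : G1) = 𝔊.l2' 0 m + 𝔊.l2' u 0 + 0; simp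
      der_l3 := fun u v w => by
        change (0 : G1) + 𝔊.l2' u 0 + 𝔊.l3 0 v w + 𝔊.l3 u 0 w + 𝔊.l3 u v 0 =
          0 + 0 + 0 - 𝔊.l2' w 0 + 𝔊.l2' v 0
        simp }
  smul_mem' f D hD :=
    { symbol := congrArg (f • ·) hD.symbol
      skew := fun u v => by
        change f • D.2.2 u v = -(f • D.2.2 v u)
        rw [hD.skew, smul_neg]
      comm_l1 := fun m => by
        change f • D.1.1.2 (𝔊.l1 m) = 𝔊.l1 (f • D.2.1.1.2 m)
        rw [hD.comm_l1, 𝔊.l1_smul]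
      der_l2 := fun u v => by
        change f • D.1.1.2 (𝔊.l2 u v) =
          𝔊.l2 (f • D.1.1.2 u) v + 𝔊.l2 u (f • D.1.1.2 v) + 𝔊.l1 (f • D.2.2 u v)
        rw [hD.der_l2, 𝔊.l1_smul, 𝔊.l2_smul, 𝔊.l2_smul_left, smul_add, smul_add]
      der_l2' := fun u m => by
        change f • D.2.1.1.2 (𝔊.l2' u m) =
          𝔊.l2' (f • D.1.1.2 u) m + 𝔊.l2' u (f • D.2.1.1.2 m) + f • D.2.2 u (𝔊.l1 m)
        rw [hD.der_l2', 𝔊.l2'_smul_right, 𝔊.l2'_smul_left, smul_add, smul_add]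
      der_l3 := fun u v w => by
        have h1 := hD.der_l3 u v w
        change f • D.2.2 u (𝔊.l2 v w) + 𝔊.l2' u (f • D.2.2 v w)
            + 𝔊.l3 (f • D.1.1.2 u) v w + 𝔊.l3 u (f • D.1.1.2 v) w
            + 𝔊.l3 u v (f • D.1.1.2 w) =
          f • D.2.1.1.2 (𝔊.l3 u v w) + f • D.2.2 (𝔊.l2 u v) w + f • D.2.2 v (𝔊.l2 u w)
            - 𝔊.l2' w (f • D.2.2 u v) + 𝔊.l2' v (f • D.2.2 u w)
        simp only [𝔊.l2'_smul_right, 𝔊.l3_smul, 𝔊.l3_smul_mid, 𝔊.l3_smul_left]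
        linear_combination (norm := module) f • h1 }

/-- `Γ(Der^0(𝔊))`, the degree `0` derivations of `𝔊`. -/
def Der0 : Type _ := 𝔊.derSubmodule

instance : AddCommGroup 𝔊.Der0 := inferInstanceAs (AddCommGroup 𝔊.derSubmodule)
instance : Module (Fn E M) 𝔊.Der0 := inferInstanceAs (Module (Fn E M) 𝔊.derSubmodule)
instance : Module ℝ 𝔊.Der0 := inferInstanceAs (Module ℝ 𝔊.derSubmodule)
instance : IsScalarTower ℝ (Fn E M) 𝔊.Der0 :=
  inferInstanceAs (IsScalarTower ℝ (Fn E M) 𝔊.derSubmodule)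

variable {𝔊}

namespace Der0

/-- the symbol `𝕛(𝔡)` -/
def symbol (D : 𝔊.Der0) : VF E M := D.1.1.1.1

/-- the operator `𝔡_0` -/
def op0 (D : 𝔊.Der0) : G0 →ₗ[ℝ] G0 := D.1.1.1.2

/-- the operator `𝔡_1` -/
def op1 (D : 𝔊.Der0) : G1 →ₗ[ℝ] G1 := D.1.2.1.1.2

/-- the form `l_𝔡` -/
def form (D : 𝔊.Der0) : G0 →ₗ[Fn E M] G0 →ₗ[Fn E M] G1 := D.1.2.2

theorem op0_smul (D : 𝔊.Der0) (f : Fn E M) (u : G0) :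
    D.op0 (f • u) = f • D.op0 u + vfDer D.symbol f • u := D.1.1.2 f u

theorem op1_smul (D : 𝔊.Der0) (f : Fn E M) (m : G1) :
    D.op1 (f • m) = f • D.op1 m + vfDer D.symbol f • m :=
  (D.1.2.1.2 f m).trans (by rw [← D.2.symbol, symbol, op1])

theorem form_skew (D : 𝔊.Der0) (u v : G0) : D.form u v = -D.form v u := D.2.skew u v

theorem op0_l1 (D : 𝔊.Der0) (m : G1) : D.op0 (𝔊.l1 m) = 𝔊.l1 (D.op1 m) := D.2.comm_l1 m

theorem op0_l2 (D : 𝔊.Der0) (u v : G0) :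
    D.op0 (𝔊.l2 u v) = 𝔊.l2 (D.op0 u) v + 𝔊.l2 u (D.op0 v) + 𝔊.l1 (D.form u v) :=
  D.2.der_l2 u v

theorem op1_l2' (D : 𝔊.Der0) (u : G0) (m : G1) :
    D.op1 (𝔊.l2' u m) = 𝔊.l2' (D.op0 u) m + 𝔊.l2' u (D.op1 m) + D.form u (𝔊.l1 m) :=
  D.2.der_l2' u m

theorem op1_l3 (D : 𝔊.Der0) (u v w : G0) :
    D.op1 (𝔊.l3 u v w) = D.form u (𝔊.l2 v w) + 𝔊.l2' u (D.form v w)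
      + 𝔊.l3 (D.op0 u) v w + 𝔊.l3 u (D.op0 v) w + 𝔊.l3 u v (D.op0 w)
      - D.form (𝔊.l2 u v) w - D.form v (𝔊.l2 u w) + 𝔊.l2' w (D.form u v)
      - 𝔊.l2' v (D.form u w) := by
  have h := D.2.der_l3 u v w
  change D.form u (𝔊.l2 v w) + 𝔊.l2' u (D.form v w) + 𝔊.l3 (D.op0 u) v w + 𝔊.l3 u (D.op0 v) w
    + 𝔊.l3 u v (D.op0 w) = D.op1 (𝔊.l3 u v w) + D.form (𝔊.l2 u v) w + D.form v (𝔊.l2 u w)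
      - 𝔊.l2' w (D.form u v) + 𝔊.l2' v (D.form u w) at h
  linear_combination (norm := module) -(1 : ℝ) • h

theorem ext {D T : 𝔊.Der0} (hs : D.symbol = T.symbol) (h0 : ∀ u, D.op0 u = T.op0 u)
    (h1 : ∀ m, D.op1 m = T.op1 m) (hl : ∀ u v, D.form u v = T.form u v) : D = T := by
  refine Subtype.ext (Prod.ext (Subtype.ext (Prod.ext hs (LinearMap.ext h0)))
    (Prod.ext (Subtype.ext (Prod.ext ?_ (LinearMap.ext h1))) (LinearMap.ext₂ hl)))
  rw [← D.2.symbol, ← T.2.symbol]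
  exact hs

/-- Constructor for degree `0` derivations from their components. -/
def mk (X : VF E M) (d0 : G0 →ₗ[ℝ] G0) (d1 : G1 →ₗ[ℝ] G1) (l : G0 → G0 → G1)
    (l_add : ∀ u u' v, l (u + u') v = l u v + l u' v)
    (l_smul : ∀ (f : Fn E M) u v, l (f • u) v = f • l u v)
    (l_skew : ∀ u v, l u v = -l v u)
    (h0 : ∀ (f : Fn E M) u, d0 (f • u) = f • d0 u + vfDer X f • u)
    (h1 : ∀ (f : Fn E M) m, d1 (f • m) = f • d1 m + vfDer X f • m)
    (h2 : ∀ m, d0 (𝔊.l1 m) = 𝔊.l1 (d1 m))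
    (h3 : ∀ u v, d0 (𝔊.l2 u v) = 𝔊.l2 (d0 u) v + 𝔊.l2 u (d0 v) + 𝔊.l1 (l u v))
    (h4 : ∀ u m, d1 (𝔊.l2' u m) = 𝔊.l2' (d0 u) m + 𝔊.l2' u (d1 m) + l u (𝔊.l1 m))
    (h5 : ∀ u v w, l u (𝔊.l2 v w) + 𝔊.l2' u (l v w)
      + 𝔊.l3 (d0 u) v w + 𝔊.l3 u (d0 v) w + 𝔊.l3 u v (d0 w) =
      d1 (𝔊.l3 u v w) + l (𝔊.l2 u v) w + l v (𝔊.l2 u w)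
      - 𝔊.l2' w (l u v) + 𝔊.l2' v (l u w)) : 𝔊.Der0 :=
  ⟨(⟨(X, d0), h0⟩, ⟨(X, d1), h1⟩, LinearMap.mk₂ (Fn E M) l l_add l_smul
      (fun u v v' => by rw [l_skew, l_add, l_skew u v, l_skew u v']; abel)
      (fun f u v => by rw [l_skew, l_smul, l_skew u v, smul_neg])),
    { symbol := rfl, skew := l_skew, comm_l1 := h2, der_l2 := h3, der_l2' := h4, der_l3 := h5 }⟩

end Der0

/-- The bracket `[𝔡, 𝔱]` of degree `0` derivations. -/
def Der0.bracket (D T : 𝔊.Der0) : 𝔊.Der0 :=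
  Der0.mk ⁅D.symbol, T.symbol⁆ (D.op0 ∘ₗ T.op0 - T.op0 ∘ₗ D.op0)
    (D.op1 ∘ₗ T.op1 - T.op1 ∘ₗ D.op1)
    (fun u v => D.op1 (T.form u v) - T.form (D.op0 u) v - T.form u (D.op0 v)
      + D.form (T.op0 u) v + D.form u (T.op0 v) - T.op1 (D.form u v))
    (fun u u' v => by simp only [map_add, LinearMap.add_apply]; abel)
    (fun f u v => by
      simp only [map_add, map_smul, LinearMap.add_apply, LinearMap.smul_apply, D.op0_smul,
        T.op0_smul, D.op1_smul, T.op1_smul]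
      module)
    (fun u v => by
      rw [T.form_skew u v, D.form_skew u v, T.form_skew (D.op0 u) v, T.form_skew u (D.op0 v),
        D.form_skew (T.op0 u) v, D.form_skew u (T.op0 v)]
      simp only [map_neg]
      abel)
    (fun f u => by
      simp only [LinearMap.sub_apply, LinearMap.comp_apply, map_add, D.op0_smul, T.op0_smul,
        vfDer_lie]
      module)
    (fun f m => by
      simp only [LinearMap.sub_apply, LinearMap.comp_apply, map_add, D.op1_smul, T.op1_smul,
        vfDer_lie]
      module)
    (fun m => by
      simp only [LinearMap.sub_apply, LinearMap.comp_apply, D.op0_l1, T.op0_l1, map_sub])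
    (fun u v => by
      simp only [LinearMap.sub_apply, LinearMap.comp_apply, D.op0_l2, T.op0_l2, map_add, map_sub,
        D.op0_l1, T.op0_l1]
      abel)
    (fun u m => by
      simp only [LinearMap.sub_apply, LinearMap.comp_apply, D.op1_l2', T.op1_l2', map_add, map_sub,
        D.op0_l1, T.op0_l1]
      abel)
    (fun u v w => by
      have hD : ∀ m x, D.form (𝔊.l1 m) x = -D.form x (𝔊.l1 m) := fun m x => D.form_skew _ _
      have hT : ∀ m x, T.form (𝔊.l1 m) x = -T.form x (𝔊.l1 m) := fun m x => T.form_skew _ _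
      simp only [LinearMap.sub_apply, LinearMap.comp_apply, LinearMap.add_apply, D.op1_l3,
        T.op1_l3, D.op1_l2', T.op1_l2', map_add, map_sub, D.op0_l2, T.op0_l2, hD, hT]
      abel)

variable (𝔊)

/-- `δ(φ)` for `φ ∈ Der^{-1}(𝔊) = Hom(𝒢_0, 𝒢_{-1})`. -/
def delta (φ : G0 →ₗ[Fn E M] G1) : 𝔊.Der0 :=
  Der0.mk 0 (𝔊.l1 ∘ₗ φ.restrictScalars ℝ) (φ.restrictScalars ℝ ∘ₗ 𝔊.l1)
    (fun u v => φ (𝔊.l2 u v) + 𝔊.l2' v (φ u) - 𝔊.l2' u (φ v))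
    (fun u u' v => by simp only [map_add, LinearMap.add_apply]; abel)
    (fun f u v => by
      simp only [𝔊.l2_smul_left, 𝔊.l2'_smul_left, 𝔊.l2'_smul_right, map_smul]
      module)
    (fun u v => by rw [𝔊.l2_skew u v, map_neg]; abel)
    (fun f u => by
      simp [𝔊.l1_smul])
    (fun f m => by
      simp [𝔊.l1_smul])
    (fun m => rfl)
    (fun u v => by
      simp only [LinearMap.comp_apply, LinearMap.restrictScalars_apply, map_add, map_sub,
        𝔊.l1_l2']
      rw [𝔊.l2_skew (𝔊.l1 (φ u)) v]
      abel)
    (fun u m => by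
      simp only [LinearMap.comp_apply, LinearMap.restrictScalars_apply, 𝔊.l1_l2']
      rw [𝔊.l2'_l1 (φ u) m]
      abel)
    (fun u v w => by
      have h1 : ∀ m x y, 𝔊.l3 (𝔊.l1 m) x y = 𝔊.l3 x y (𝔊.l1 m) := fun m x y => by
        rw [𝔊.l3_skew_left, 𝔊.l3_skew_right, neg_neg]
      have h2 : ∀ m x y, 𝔊.l3 x (𝔊.l1 m) y = -𝔊.l3 x y (𝔊.l1 m) := fun m x y =>
        𝔊.l3_skew_right _ _ _
      simp only [LinearMap.comp_apply, LinearMap.restrictScalars_apply, h1, h2, 𝔊.jacobi',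
        𝔊.jacobi, map_add, map_sub]
      abel)

/-- `(ad^0_u, ad^1_u, l_{ad_u})` for `u ∈ Γ(𝒢_0)`. -/
def ad (u : G0) : 𝔊.Der0 :=
  Der0.mk 0 (𝔊.l2 u) (𝔊.l2' u) (fun v w => 𝔊.l3 u v w)
    (fun v v' w => by simp only [map_add, LinearMap.add_apply])
    (fun f v w => 𝔊.l3_smul_mid f u v w)
    (fun v w => 𝔊.l3_skew_right u v w)
    (fun f v => by simp [𝔊.l2_smul])
    (fun f v => by simp [𝔊.l2'_smul_right])
    (fun m => (𝔊.l1_l2' u m).symm)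
    (fun v w => by rw [𝔊.jacobi]; abel)
    (fun v m => by rw [𝔊.jacobi']; abel)
    (fun v w z => by
      have h := 𝔊.jacobiator u v w z
      linear_combination (norm := module) -(1 : ℝ) • h)


/-- `Γ(DER^{-1}(𝔊)) = Γ(Der^{-1}(𝔊)) ⊕ Γ(𝒢_0)`; its elements `(φ, u)` are written `φ + u`. -/
abbrev DER1 (_ : Lie2AlgebraBundle E M G0 G1) : Type _ := (G0 →ₗ[Fn E M] G1) × G0

/-- `-l_2(m, ·)` as an element of `Der^{-1}(𝔊)`, for `m ∈ Γ(𝒢_{-1})`. -/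
def adHom (m : G1) : G0 →ₗ[Fn E M] G1 where
  toFun u := 𝔊.l2' u m
  map_add' u v := by simp only [map_add, LinearMap.add_apply]
  map_smul' f u := 𝔊.l2'_smul_left f u m

variable {𝔊}

namespace Der0

/-- `[𝔡, φ] = 𝔡_1 ∘ φ - φ ∘ 𝔡_0` for `φ ∈ Der^{-1}(𝔊)`. -/
def bracketHom (D : 𝔊.Der0) (φ : G0 →ₗ[Fn E M] G1) : G0 →ₗ[Fn E M] G1 where
  toFun u := D.op1 (φ u) - φ (D.op0 u)
  map_add' u v := by simp only [map_add]; abel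
  map_smul' f u := by
    simp only [map_smul, map_add, D.op0_smul, D.op1_smul, RingHom.id_apply]
    module

theorem bracketHom_apply (D : 𝔊.Der0) (φ : G0 →ₗ[Fn E M] G1) (u : G0) :
    D.bracketHom φ u = D.op1 (φ u) - φ (D.op0 u) := rfl

theorem adHom_apply (m : G1) (u : G0) : 𝔊.adHom m u = 𝔊.l2' u m := rfl

theorem symbol_add (D T : 𝔊.Der0) : (D + T).symbol = D.symbol + T.symbol := rfl
theorem symbol_neg (D : 𝔊.Der0) : (-D).symbol = -D.symbol := rfl
theorem symbol_zero : (0 : 𝔊.Der0).symbol = 0 := rfl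
theorem symbol_smul (f : Fn E M) (D : 𝔊.Der0) : (f • D).symbol = f • D.symbol := rfl
theorem symbol_rsmul (c : ℝ) (D : 𝔊.Der0) : (c • D).symbol = c • D.symbol := rfl
theorem symbol_bracket (D T : 𝔊.Der0) : (D.bracket T).symbol = ⁅D.symbol, T.symbol⁆ := rfl
theorem symbol_delta (φ : G0 →ₗ[Fn E M] G1) : (𝔊.delta φ).symbol = 0 := rfl
theorem symbol_ad (u : G0) : (𝔊.ad u).symbol = 0 := rfl

theorem op0_add (D T : 𝔊.Der0) (u : G0) : (D + T).op0 u = D.op0 u + T.op0 u := rfl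
theorem op0_neg (D : 𝔊.Der0) (u : G0) : (-D).op0 u = -D.op0 u := rfl
theorem op0_zero (u : G0) : (0 : 𝔊.Der0).op0 u = 0 := rfl
theorem op0_fsmul (f : Fn E M) (D : 𝔊.Der0) (u : G0) : (f • D).op0 u = f • D.op0 u := rfl
theorem op0_rsmul (c : ℝ) (D : 𝔊.Der0) (u : G0) : (c • D).op0 u = c • D.op0 u := rfl
theorem op0_bracket (D T : 𝔊.Der0) (u : G0) :
    (D.bracket T).op0 u = D.op0 (T.op0 u) - T.op0 (D.op0 u) := rfl
theorem op0_delta (φ : G0 →ₗ[Fn E M] G1) (u : G0) : (𝔊.delta φ).op0 u = 𝔊.l1 (φ u) := rfl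
theorem op0_ad (u v : G0) : (𝔊.ad u).op0 v = 𝔊.l2 u v := rfl

theorem op1_add (D T : 𝔊.Der0) (m : G1) : (D + T).op1 m = D.op1 m + T.op1 m := by
  change D.1.2.1.1.2 m + T.1.2.1.1.2 m = _; rfl
theorem op1_neg (D : 𝔊.Der0) (m : G1) : (-D).op1 m = -D.op1 m := rfl
theorem op1_zero (m : G1) : (0 : 𝔊.Der0).op1 m = 0 := rfl
theorem op1_fsmul (f : Fn E M) (D : 𝔊.Der0) (m : G1) : (f • D).op1 m = f • D.op1 m := rfl
theorem op1_rsmul (c : ℝ) (D : 𝔊.Der0) (m : G1) : (c • D).op1 m = c • D.op1 m := rfl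
theorem op1_bracket (D T : 𝔊.Der0) (m : G1) :
    (D.bracket T).op1 m = D.op1 (T.op1 m) - T.op1 (D.op1 m) := rfl
theorem op1_delta (φ : G0 →ₗ[Fn E M] G1) (m : G1) : (𝔊.delta φ).op1 m = φ (𝔊.l1 m) := rfl
theorem op1_ad (u : G0) (m : G1) : (𝔊.ad u).op1 m = 𝔊.l2' u m := rfl

theorem form_add (D T : 𝔊.Der0) (u v : G0) : (D + T).form u v = D.form u v + T.form u v := rfl
theorem form_neg (D : 𝔊.Der0) (u v : G0) : (-D).form u v = -D.form u v := rfl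
theorem form_zero (u v : G0) : (0 : 𝔊.Der0).form u v = 0 := rfl
theorem form_fsmul (f : Fn E M) (D : 𝔊.Der0) (u v : G0) :
    (f • D).form u v = f • D.form u v := rfl
theorem form_rsmul (c : ℝ) (D : 𝔊.Der0) (u v : G0) : (c • D).form u v = c • D.form u v := rfl
theorem form_bracket (D T : 𝔊.Der0) (u v : G0) : (D.bracket T).form u v =
    D.op1 (T.form u v) - T.form (D.op0 u) v - T.form u (D.op0 v)
      + D.form (T.op0 u) v + D.form u (T.op0 v) - T.op1 (D.form u v) := rfl
theorem form_delta (φ : G0 →ₗ[Fn E M] G1) (u v : G0) : (𝔊.delta φ).form u v =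
    φ (𝔊.l2 u v) + 𝔊.l2' v (φ u) - 𝔊.l2' u (φ v) := rfl
theorem form_ad (u v w : G0) : (𝔊.ad u).form v w = 𝔊.l3 u v w := rfl

end Der0

variable (𝔊)

set_option maxHeartbeats 1000000 in
open Der0 in
/-- The strict Lie 3-algebroid `DER(𝔊)`. -/
def DER : StrictLie3Algebroid E M 𝔊.Der0 𝔊.DER1 G1 where
  anchor :=
    { toFun := fun D => D.symbol
      map_add' := fun _ _ => rfl
      map_smul' := fun _ _ => rfl }
  d1 :=
    { toFun := fun a => 𝔊.delta a.1 + 𝔊.ad a.2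
      map_add' := fun a b => by
        apply Der0.ext
        · simp [symbol_add, symbol_delta, symbol_ad]
        all_goals
          intros
          simp only [op0_add, op0_delta, op0_ad, op1_add, op1_delta, op1_ad, form_add, form_delta,
            form_ad, Prod.fst_add, Prod.snd_add, LinearMap.add_apply, map_add]
          abel
      map_smul' := fun f a => by
        apply Der0.ext
        · simp [symbol_add, symbol_delta, symbol_ad, symbol_smul]
        all_goals
          intros
          simp only [op0_add, op0_delta, op0_ad, op1_add, op1_delta, op1_ad, form_add, form_delta,
            form_ad, op0_fsmul, op1_fsmul, form_fsmul, Prod.smul_fst, Prod.smul_snd,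
            LinearMap.smul_apply, RingHom.id_apply, 𝔊.l1_smul, 𝔊.l2_smul_left, 𝔊.l2'_smul_left,
            𝔊.l2'_smul_right, 𝔊.l3_smul_left]
          module }
  d2 :=
    { toFun := fun m => (𝔊.adHom m, 𝔊.l1 m)
      map_add' := fun m n => by
        refine Prod.ext (LinearMap.ext fun u => ?_) (map_add _ _ _)
        exact map_add (𝔊.l2' u) m n
      map_smul' := fun f m => by
        refine Prod.ext (LinearMap.ext fun u => ?_) (𝔊.l1_smul f m)
        exact 𝔊.l2'_smul_right u f m }
  b00 := LinearMap.mk₂ ℝ Der0.bracket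
    (fun D D' T => by
      apply Der0.ext
      · simp [symbol_add, symbol_bracket]
      all_goals
        intros
        simp only [op0_add, op1_add, form_add, op0_bracket, op1_bracket, form_bracket, map_add,
          LinearMap.add_apply]
        abel)
    (fun c D T => by
      apply Der0.ext
      · simp [symbol_rsmul, symbol_bracket]
      all_goals
        intros
        simp only [op0_rsmul, op1_rsmul, form_rsmul, op0_bracket, op1_bracket, form_bracket,
          map_smul, LinearMap.map_smul_of_tower, LinearMap.smul_apply]
        module)
    (fun D T T' => by
      apply Der0.ext
      · simp [symbol_add, symbol_bracket]
      all_goals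
        intros
        simp only [op0_add, op1_add, form_add, op0_bracket, op1_bracket, form_bracket, map_add,
          LinearMap.add_apply]
        abel)
    (fun c D T => by
      apply Der0.ext
      · simp [symbol_rsmul, symbol_bracket]
      all_goals
        intros
        simp only [op0_rsmul, op1_rsmul, form_rsmul, op0_bracket, op1_bracket, form_bracket,
          map_smul, LinearMap.map_smul_of_tower, LinearMap.smul_apply]
        module)
  b01 := LinearMap.mk₂ ℝ (fun D a => (D.bracketHom a.1 + D.form a.2, D.op0 a.2))
    (fun D T a => by
      refine Prod.ext (LinearMap.ext fun u => ?_) rfl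
      simp only [LinearMap.add_apply, bracketHom_apply, op0_add, op1_add, form_add, map_add,
        Prod.fst_add]
      abel)
    (fun c D a => by
      refine Prod.ext (LinearMap.ext fun u => ?_) rfl
      simp only [LinearMap.add_apply, bracketHom_apply, op0_rsmul, op1_rsmul, form_rsmul,
        LinearMap.map_smul_of_tower, Prod.smul_fst, LinearMap.smul_apply]
      module)
    (fun D a b => by
      refine Prod.ext (LinearMap.ext fun u => ?_) (map_add _ _ _)
      simp only [LinearMap.add_apply, bracketHom_apply, map_add, Prod.fst_add, Prod.snd_add]
      abel)
    (fun c D a => by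
      refine Prod.ext (LinearMap.ext fun u => ?_) (map_smul _ _ _)
      simp only [LinearMap.add_apply, bracketHom_apply, map_smul, LinearMap.map_smul_of_tower,
        Prod.smul_fst, Prod.smul_snd, LinearMap.smul_apply]
      module)
  b02 := LinearMap.mk₂ ℝ (fun D m => D.op1 m) op1_add op1_rsmul
    (fun D m n => map_add _ _ _) (fun c D m => map_smul _ _ _)
  b11 := LinearMap.mk₂ ℝ (fun a b => a.1 b.2 + b.1 a.2)
    (fun a a' b => by simp only [Prod.fst_add, Prod.snd_add, LinearMap.add_apply, map_add]; abel)
    (fun c a b => by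
      simp only [Prod.smul_fst, Prod.smul_snd, LinearMap.smul_apply, LinearMap.map_smul_of_tower,
        smul_add])
    (fun a b b' => by simp only [Prod.fst_add, Prod.snd_add, LinearMap.add_apply, map_add]; abel)
    (fun c a b => by
      simp only [Prod.smul_fst, Prod.smul_snd, LinearMap.smul_apply, LinearMap.map_smul_of_tower,
        smul_add])
  b00_skew D T := by
    simp only [LinearMap.mk₂_apply]
    apply Der0.ext
    · simp [symbol_bracket, symbol_neg]
    all_goals
      intros
      simp only [op0_neg, op1_neg, form_neg, op0_bracket, op1_bracket, form_bracket]
      abel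
  b11_symm a b := by
    simp only [LinearMap.mk₂_apply]
    abel
  d1_d2 m := by
    simp only [LinearMap.coe_mk, AddHom.coe_mk]
    apply Der0.ext
    · simp [symbol_add, symbol_delta, symbol_ad, symbol_zero]
    · intro u
      simp only [op0_add, op0_delta, op0_ad, op0_zero, adHom_apply, 𝔊.l1_l2']
      rw [𝔊.l2_skew u]
      abel
    · intro n
      simp only [op1_add, op1_delta, op1_ad, op1_zero, adHom_apply]
      rw [𝔊.l2'_l1 n m]
      abel
    · intro u v
      simp only [form_add, form_delta, form_ad, form_zero, adHom_apply]
      rw [𝔊.l3_skew_left, 𝔊.l3_skew_right, neg_neg, 𝔊.jacobi']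
      abel
  d1_b01 D a := by
    simp only [LinearMap.coe_mk, AddHom.coe_mk, LinearMap.mk₂_apply]
    apply Der0.ext
    · simp [symbol_add, symbol_delta, symbol_ad, symbol_bracket]
    · intro u
      simp only [op0_add, op0_delta, op0_ad, op0_bracket, LinearMap.add_apply, bracketHom_apply,
        map_add, map_sub, D.op0_l1, D.op0_l2]
      abel
    · intro m
      simp only [op1_add, op1_delta, op1_ad, op1_bracket, LinearMap.add_apply, bracketHom_apply,
        map_add, D.op0_l1, D.op1_l2']
      abel
    · intro u v
      have hD : ∀ m x, D.form (𝔊.l1 m) x = -D.form x (𝔊.l1 m) := fun m x => D.form_skew _ _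
      simp only [form_add, form_delta, form_ad, form_bracket, LinearMap.add_apply,
        bracketHom_apply, map_add, map_sub, D.op0_l2, D.op1_l2', D.op1_l3, op0_add, op1_add,
        op0_delta, op0_ad, op1_delta, op1_ad, hD]
      abel
  d2_b02 D m := by
    simp only [LinearMap.coe_mk, AddHom.coe_mk, LinearMap.mk₂_apply]
    refine Prod.ext (LinearMap.ext fun u => ?_) (D.op0_l1 m).symm
    simp only [LinearMap.add_apply, bracketHom_apply, adHom_apply, D.op1_l2']
    rw [D.form_skew (𝔊.l1 m) u]
    abel
  d2_b11 a b := by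
    simp only [LinearMap.coe_mk, AddHom.coe_mk, LinearMap.mk₂_apply]
    refine Prod.ext (LinearMap.ext fun u => ?_) ?_
    · simp only [Prod.fst_add, LinearMap.add_apply, bracketHom_apply, adHom_apply, op0_add,
        op1_add, op0_delta, op0_ad, op1_delta, op1_ad, form_add, form_delta, form_ad, map_add]
      rw [𝔊.l3_skew_left a.2]
      abel
    · simp only [Prod.snd_add, op0_add, op0_delta, op0_ad, map_add]
      rw [𝔊.l2_skew a.2]
      abel
  b02_d1 a m := by
    simp only [LinearMap.coe_mk, AddHom.coe_mk, LinearMap.mk₂_apply]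
    rfl
  jacobi000 D T S := by
    simp only [LinearMap.mk₂_apply]
    apply Der0.ext
    · exact leibniz_lie _ _ _
    all_goals
      intros
      simp only [op0_add, op1_add, form_add, op0_bracket, op1_bracket, form_bracket, map_add,
        map_sub, LinearMap.sub_apply]
      abel
  jacobi001 D T a := by
    simp only [LinearMap.mk₂_apply]
    refine Prod.ext (LinearMap.ext fun u => ?_) ?_
    · simp only [Prod.fst_add, LinearMap.add_apply, bracketHom_apply, op0_bracket, op1_bracket,
        form_bracket, map_add, map_sub]
      abel
    · simp only [Prod.snd_add, op0_bracket]
      abel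
  jacobi002 D T m := by
    simp only [LinearMap.mk₂_apply, op1_bracket]
    abel
  jacobi011 D a b := by
    simp only [LinearMap.mk₂_apply, LinearMap.add_apply, bracketHom_apply, map_add]
    rw [D.form_skew a.2]
    abel
  b00_leibniz D f T := by
    simp only [LinearMap.mk₂_apply]
    apply Der0.ext
    · exact vf_lie_smul _ _ _
    · intro u
      simp only [op0_bracket, op0_add, op0_fsmul, D.op0_smul]
      module
    · intro m
      simp only [op1_bracket, op1_add, op1_fsmul, D.op1_smul]
      module
    · intro u v
      simp only [form_bracket, form_add, form_fsmul, op0_fsmul, op1_fsmul, D.op1_smul,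
        map_smul, LinearMap.smul_apply]
      module
  b01_leibniz D f a := by
    simp only [LinearMap.mk₂_apply]
    refine Prod.ext (LinearMap.ext fun u => ?_) (D.op0_smul f a.2)
    simp only [Prod.fst_add, Prod.smul_fst, Prod.smul_snd, LinearMap.add_apply,
      LinearMap.smul_apply, bracketHom_apply, D.op1_smul, map_smul]
    module
  b02_leibniz D f m := D.op1_smul f m
  b01_smul f D a := by
    simp only [LinearMap.mk₂_apply]
    refine Prod.ext (LinearMap.ext fun u => ?_) rfl
    simp only [Prod.smul_fst, LinearMap.add_apply, LinearMap.smul_apply, bracketHom_apply,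
      op0_fsmul, op1_fsmul, form_fsmul, map_smul]
    module
  b02_smul f D m := rfl
  b11_smul a f b := by
    simp only [LinearMap.mk₂_apply, Prod.smul_fst, Prod.smul_snd, LinearMap.smul_apply, map_smul,
      smul_add]

end Lie2AlgebraBundle
end Derivations

section Transitive

variable {E M : Type*} [NormedAddCommGroup E] [NormedSpace ℝ E] [FiniteDimensional ℝ E]
  [TopologicalSpace M] [ChartedSpace E M] [IsManifold 𝓘(ℝ, E) ∞ M]
  {L0 L1 : Type*}
  [AddCommGroup L0] [Module ℝ L0] [Module (Fn E M) L0] [IsScalarTower ℝ (Fn E M) L0]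
  [AddCommGroup L1] [Module ℝ L1] [Module (Fn E M) L1] [IsScalarTower ℝ (Fn E M) L1]

namespace Lie2Algebroid

variable (A : Lie2Algebroid E M L0 L1)

/-- The anchor is fibrewise surjective: every tangent vector is a value of the anchor of a
section. -/
def Transitive : Prop :=
  ∀ (x : M) (v : TangentSpace 𝓘(ℝ, E) x), ∃ a : L0, A.anchor a x = v

/-- `Γ(𝒢)` for `𝒢 = ker ρ`. -/
abbrev ker : Submodule (Fn E M) L0 := LinearMap.ker A.anchor

variable {A}

theorem Transitive.eq_zero [T2Space M] (hA : A.Transitive) (D : VF E M)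
    (h : ∀ (f : Fn E M) (z : L0), vfDer D f • z = 0) : D = 0 := by
  apply vf_eq_zero
  intro f
  ext x
  obtain ⟨z, hz⟩ := hA x (D x)
  have h1 : vfDer D f • A.anchor z = 0 := by rw [← map_smul, h, map_zero]
  have h2 : vfDer D f x • D x = 0 := by
    rw [← hz]; exact congrArg (fun W : VF E M => W x) h1
  have h3 := congrArg (mvfderiv 𝓘(ℝ, E) f x) h2
  rw [map_smul, map_zero] at h3
  change vfDer D f x * vfDer D f x = 0 at h3
  exact mul_self_eq_zero.mp h3

theorem Transitive.anchor_l1 [T2Space M] (hA : A.Transitive) (m : L1) :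
    A.anchor (A.l1 m) = 0 := by
  apply hA.eq_zero
  intro f z
  have h1 := A.l1_l2' (f • z) m
  rw [A.l2'_smul, A.l1_smul, A.l1_l2', A.l2_skew (f • z), A.l2_leibniz, A.l2_skew z] at h1
  linear_combination (norm := module) h1

theorem Transitive.anchor_l2 [T2Space M] (hA : A.Transitive) (x y : L0) :
    A.anchor (A.l2 x y) = ⁅A.anchor x, A.anchor y⁆ := by
  rw [← sub_eq_zero]
  apply hA.eq_zero
  intro f z
  have h1 := A.jacobi x y (f • z)
  have h2 := A.jacobi x y z
  simp only [A.l3_smul, A.l1_smul, A.l2_leibniz, map_add] at h1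
  rw [h2] at h1
  rw [map_sub, Derivation.sub_apply, vfDer_lie]
  linear_combination (norm := module) h1

/-- The graded bundle of Lie 2-algebras `(A_{-1} ⊕ ker ρ; 𝔩_1, 𝔩_2, 𝔩_3)` of a transitive Lie
2-algebroid, obtained by restricting the brackets. -/
def kerBundle [T2Space M] (hA : A.Transitive) : Lie2AlgebraBundle E M A.ker L1 where
  l1 :=
    { toFun := fun m => ⟨A.l1 m, hA.anchor_l1 m⟩
      map_add' := fun m n => Subtype.ext (map_add _ _ _)
      map_smul' := fun c m => Subtype.ext (map_smul _ _ _) }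
  l2 := LinearMap.mk₂ ℝ
    (fun u v => ⟨A.l2 u v, by
      rw [LinearMap.mem_ker, hA.anchor_l2, LinearMap.mem_ker.mp u.2, zero_lie]⟩)
    (fun u u' v => Subtype.ext (LinearMap.map_add₂ A.l2 (u : L0) u' v))
    (fun c u v => Subtype.ext (LinearMap.map_smul₂ A.l2 c (u : L0) v))
    (fun u v v' => Subtype.ext (map_add (A.l2 (u : L0)) (v : L0) v'))
    (fun c u v => Subtype.ext (map_smul (A.l2 (u : L0)) c (v : L0)))
  l2' := A.l2' ∘ₗ A.ker.subtype.restrictScalars ℝ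
  l3 := LinearMap.mk₂ ℝ (fun u v => A.l3 (u : L0) (v : L0) ∘ₗ A.ker.subtype.restrictScalars ℝ)
    (fun u u' v => LinearMap.ext fun w =>
      congrArg (fun L => L (w : L0)) (LinearMap.map_add₂ A.l3 (u : L0) u' v))
    (fun c u v => LinearMap.ext fun w =>
      congrArg (fun L => L (w : L0)) (LinearMap.map_smul₂ A.l3 c (u : L0) v))
    (fun u v v' => LinearMap.ext fun w =>
      congrArg (fun L => L (w : L0)) (map_add (A.l3 (u : L0)) (v : L0) v'))
    (fun c u v => LinearMap.ext fun w =>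
      congrArg (fun L => L (w : L0)) (map_smul (A.l3 (u : L0)) c (v : L0)))
  l2_skew u v := Subtype.ext (A.l2_skew u v)
  l3_skew_left u v w := A.l3_skew_left u v w
  l3_skew_right u v w := A.l3_skew_right u v w
  l1_l2' u m := Subtype.ext (A.l1_l2' u m)
  l2'_l1 m n := A.l2'_l1 m n
  jacobi u v w := Subtype.ext (A.jacobi u v w)
  jacobi' u v m := A.jacobi' u v m
  jacobiator u v w z := A.jacobiator u v w z
  l1_smul f m := Subtype.ext (A.l1_smul f m)
  l2_smul u f v := Subtype.ext (by
    have h := A.l2_leibniz (u : L0) f v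
    rw [LinearMap.mem_ker.mp u.2, map_zero, Derivation.zero_apply, zero_smul, add_zero] at h
    exact h)
  l2'_smul_right u f m := by
    have h := A.l2'_leibniz (u : L0) f m
    rw [LinearMap.mem_ker.mp u.2, map_zero, Derivation.zero_apply, zero_smul, add_zero] at h
    exact h
  l2'_smul_left f u m := A.l2'_smul f u m
  l3_smul u v f w := A.l3_smul u v f w

variable (A)

/-- A splitting `(σ, γ)` of a transitive Lie 2-algebroid. -/
structure Splitting where
  σ : VF E M →ₗ[Fn E M] L0
  anchor_σ : ∀ X, A.anchor (σ X) = X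
  γ : VF E M →ₗ[Fn E M] VF E M →ₗ[Fn E M] L1
  γ_skew : ∀ X Y, γ X Y = -γ Y X

variable {A}

namespace Splitting

variable (S : A.Splitting)

/-- `∇^0_X u = l_2(σ(X), u)` (as a section of `A_0`; its values lie in `ker ρ`) -/
def nabla0 (X : VF E M) (u : A.ker) : L0 := A.l2 (S.σ X) u

/-- `∇^1_X m = l_2(σ(X), m)` -/
def nabla1 (X : VF E M) (m : L1) : L1 := A.l2' (S.σ X) m

/-- `d_{∇^1} θ` for a 2-form `θ` with values in `A_{-1}` -/
def dNabla1 (θ : VF E M → VF E M → L1) (X Y Z : VF E M) : L1 :=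
  S.nabla1 X (θ Y Z) - S.nabla1 Y (θ X Z) + S.nabla1 Z (θ X Y)
    - θ ⁅X, Y⁆ Z + θ ⁅X, Z⁆ Y - θ ⁅Y, Z⁆ X

/-- `R(X, Y) = σ[X, Y] - l_2(σ(X), σ(Y)) - 𝔩_1 γ(X, Y)` -/
def R (X Y : VF E M) : L0 := S.σ ⁅X, Y⁆ - A.l2 (S.σ X) (S.σ Y) - A.l1 (S.γ X Y)

/-- `I(X, Y, Z) = -d_{∇^1}γ(X, Y, Z) - l_3(σ(X), σ(Y), σ(Z))` -/
def I (X Y Z : VF E M) : L1 :=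
  -S.dNabla1 (fun X Y => S.γ X Y) X Y Z - A.l3 (S.σ X) (S.σ Y) (S.σ Z)

/-- `J(X, Y, u) = -l_3(σ(X), σ(Y), u)` -/
def J (X Y : VF E M) (u : A.ker) : L1 := -A.l3 (S.σ X) (S.σ Y) u

/-- `K(X, u, v) = l_3(σ(X), u, v)` -/
def K (X : VF E M) (u v : A.ker) : L1 := A.l3 (S.σ X) u v

/-- `R_γ = R + 𝔩_1 ∘ γ` -/
def Rγ (X Y : VF E M) : L0 := S.R X Y + A.l1 (S.γ X Y)

/-- `I_γ = I + d_{∇^1}γ` -/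
def Iγ (X Y Z : VF E M) : L1 := S.I X Y Z + S.dNabla1 (fun X Y => S.γ X Y) X Y Z

end Splitting
end Lie2Algebroid
end Transitive

section SplitForm

variable {E M : Type*} [NormedAddCommGroup E] [NormedSpace ℝ E] [FiniteDimensional ℝ E]
  [TopologicalSpace M] [ChartedSpace E M] [IsManifold 𝓘(ℝ, E) ∞ M]

/-- A strict isomorphism of Lie 2-algebroids over the identity of `M`: a pair of `C^∞(M)`-linear
isomorphisms preserving the anchor and all brackets. -/
structure Lie2Algebroid.IsStrictIso {K0 K1 L0 L1 : Type*}
    [AddCommGroup K0] [Module ℝ K0] [Module (Fn E M) K0] [IsScalarTower ℝ (Fn E M) K0]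
    [AddCommGroup K1] [Module ℝ K1] [Module (Fn E M) K1] [IsScalarTower ℝ (Fn E M) K1]
    [AddCommGroup L0] [Module ℝ L0] [Module (Fn E M) L0] [IsScalarTower ℝ (Fn E M) L0]
    [AddCommGroup L1] [Module ℝ L1] [Module (Fn E M) L1] [IsScalarTower ℝ (Fn E M) L1]
    (B : Lie2Algebroid E M K0 K1) (A : Lie2Algebroid E M L0 L1)
    (e0 : K0 ≃ₗ[Fn E M] L0) (e1 : K1 ≃ₗ[Fn E M] L1) : Prop where
  anchor : ∀ x, A.anchor (e0 x) = B.anchor x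
  l1 : ∀ m, A.l1 (e1 m) = e0 (B.l1 m)
  l2 : ∀ x y, A.l2 (e0 x) (e0 y) = e0 (B.l2 x y)
  l2' : ∀ x m, A.l2' (e0 x) (e1 m) = e1 (B.l2' x m)
  l3 : ∀ x y z, A.l3 (e0 x) (e0 y) (e0 z) = e1 (B.l3 x y z)

/-- `B` is the Lie 2-algebroid structure on `𝒢_{-1} ⊕ (TM ⊕ 𝒢_0)` assembled from `𝔊` and a
morphism `F = (F^1, F^2, F^3)` with `F^1(X) = (∇^0_X, ∇^1_X, K(X, ·, ·))`, `F^2 = J + R` and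
`F^3 = I`. -/
structure Lie2AlgebraBundle.IsSplitForm {G0 G1 : Type*}
    [AddCommGroup G0] [Module ℝ G0] [Module (Fn E M) G0] [IsScalarTower ℝ (Fn E M) G0]
    [AddCommGroup G1] [Module ℝ G1] [Module (Fn E M) G1] [IsScalarTower ℝ (Fn E M) G1]
    (𝔊 : Lie2AlgebraBundle E M G0 G1) (F : (tangentLieAlgebroid E M).Morphism 𝔊.DER)
    (B : Lie2Algebroid E M (VF E M × G0) G1) : Prop where
  anchor : ∀ X u, B.anchor (X, u) = X
  l1 : ∀ m, B.l1 m = (0, 𝔊.l1 m)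
  l2 : ∀ X u Y v, B.l2 (X, u) (Y, v) =
    (⁅X, Y⁆, -(F.F2 X Y).2 + (F.F1 X).op0 v - (F.F1 Y).op0 u + 𝔊.l2 u v)
  l2' : ∀ X u m, B.l2' (X, u) m = (F.F1 X).op1 m + 𝔊.l2' u m
  l3 : ∀ X u Y v Z w, B.l3 (X, u) (Y, v) (Z, w) =
    -F.F3 X Y Z - (F.F2 X Y).1 w + (F.F2 X Z).1 v - (F.F2 Y Z).1 u
      + (F.F1 X).form v w - (F.F1 Y).form u w + (F.F1 Z).form u v + 𝔊.l3 u v w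

end SplitForm

end

/-! A section `σ` of the anchor identifies Γ(A_0) with 𝔛(M) ⊕ Γ(ker ρ). Every bracket of `A` then
breaks into components according to how many of its arguments are vector fields. The components of
`l2` are [X,Y] - R_γ, ∇^0 and 𝔩_2; those of `l2'` are ∇^1 and 𝔩_2; those of `l3` are, up to sign,
I_γ, J, K and 𝔩_3. This is exactly the data of (𝔊, F^1, F^2, F^3), so the theorem is a dictionary
between identities.

With k vector fields among the arguments, the axioms of a Lie 2-algebra translate as follows. k = 0:
the axioms of 𝔊. k = 1: F^1(X) is a degree 0 derivation; `jacobi`, `jacobi'` and `jacobiator` give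
its compatibility with 𝔩_2 on 𝒢_0, with 𝔩_2 on 𝒢_{-1} and with 𝔩_3. k = 2: the three axioms give the
components of `eq2` on 𝒢_0, on 𝒢_{-1} and on the 2-form. k = 3: `jacobi` gives the 𝒢_0 component of
`eq3`, and `jacobiator` its Hom(𝒢_0, 𝒢_{-1}) component. k = 4: `jacobiator` gives `eq4`. The Leibniz
rules correspond to the condition that F^1(X) has symbol X.

Read from `A` to F, the dictionary gives `derivation_lie` and `morphism`. Read from F to `A`, it
gives `splitTernary_jacobi`, `splitTernary_l1` and `splitTernary_jacobiator`, where
`jacobiatorDefect_eq_zero` justifies testing the coherence law on pure arguments only. The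
comparison `isStrictIso_equiv` is then just multilinear expansion. -/

/-! ### From a splitting to a morphism into DER(𝔊). -/

section SplittingMorphism

variable {E M : Type*} [NormedAddCommGroup E] [NormedSpace ℝ E] [FiniteDimensional ℝ E]
  [TopologicalSpace M] [ChartedSpace E M] [IsManifold 𝓘(ℝ, E) ∞ M] [T2Space M]
  {L0 L1 : Type*}
  [AddCommGroup L0] [Module ℝ L0] [Module (Fn E M) L0] [IsScalarTower ℝ (Fn E M) L0]
  [AddCommGroup L1] [Module ℝ L1] [Module (Fn E M) L1] [IsScalarTower ℝ (Fn E M) L1]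

namespace Lie2Algebroid

variable {A : Lie2Algebroid E M L0 L1}

theorem l2_smul_left (f : Fn E M) (x y : L0) :
    A.l2 (f • x) y = f • A.l2 x y - vfDer (A.anchor y) f • x := by
  rw [A.l2_skew, A.l2_leibniz, A.l2_skew y x]
  module

theorem l3_smul_mid (x : L0) (f : Fn E M) (y z : L0) : A.l3 x (f • y) z = f • A.l3 x y z := by
  rw [A.l3_skew_right, A.l3_smul, A.l3_skew_right x y z, smul_neg]

theorem l3_smul_left (f : Fn E M) (x y z : L0) : A.l3 (f • x) y z = f • A.l3 x y z := by
  rw [A.l3_skew_left, l3_smul_mid, A.l3_skew_left x y z, smul_neg]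

theorem l3_rotate (x y z : L0) : A.l3 x y z = A.l3 y z x := by
  rw [A.l3_skew_left, A.l3_skew_right, neg_neg]

namespace Splitting

variable (S : A.Splitting) (hA : A.Transitive)

/-- The degree `0` derivation `(∇^0_X, ∇^1_X, K(X, ·, ·))` of `𝔊`. -/
noncomputable def derivation (X : VF E M) : (A.kerBundle hA).Der0 :=
  Lie2AlgebraBundle.Der0.mk X
    { toFun := fun u => ⟨A.l2 (S.σ X) u, by
        rw [LinearMap.mem_ker, hA.anchor_l2, LinearMap.mem_ker.mp u.2, lie_zero]⟩
      map_add' := fun u v => Subtype.ext (map_add (A.l2 (S.σ X)) (u : L0) v)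
      map_smul' := fun c u => Subtype.ext (map_smul (A.l2 (S.σ X)) c (u : L0)) }
    (A.l2' (S.σ X)) (fun u v => A.l3 (S.σ X) u v)
    (fun u u' v => by
      simp only [Submodule.coe_add, map_add, LinearMap.add_apply])
    (fun f u v => l3_smul_mid _ _ _ _)
    (fun u v => A.l3_skew_right _ _ _)
    (fun f u => Subtype.ext (by
      change A.l2 (S.σ X) (f • (u : L0)) = f • A.l2 (S.σ X) u + vfDer X f • (u : L0)
      rw [A.l2_leibniz, S.anchor_σ]))
    (fun f m => by rw [A.l2'_leibniz, S.anchor_σ])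
    (fun m => Subtype.ext (A.l1_l2' _ _).symm)
    (fun u v => Subtype.ext (by
      change A.l2 (S.σ X) (A.l2 (u : L0) v) =
        A.l2 (A.l2 (S.σ X) u) v + A.l2 u (A.l2 (S.σ X) v) + A.l1 (A.l3 (S.σ X) u v)
      rw [A.jacobi]
      abel))
    (fun u m => by
      change A.l2' (S.σ X) (A.l2' (u : L0) m) =
        A.l2' (A.l2 (S.σ X) u) m + A.l2' u (A.l2' (S.σ X) m) + A.l3 (S.σ X) u (A.l1 m)
      rw [A.jacobi']
      abel)
    (fun u v w => by
      change A.l3 (S.σ X) u (A.l2 v w) + A.l2' u (A.l3 (S.σ X) v w)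
        + A.l3 (A.l2 (S.σ X) u) v w + A.l3 u (A.l2 (S.σ X) v) w + A.l3 u v (A.l2 (S.σ X) w) =
        A.l2' (S.σ X) (A.l3 u v w) + A.l3 (S.σ X) (A.l2 u v) w + A.l3 (S.σ X) v (A.l2 u w)
        - A.l2' w (A.l3 (S.σ X) u v) + A.l2' v (A.l3 (S.σ X) u w)
      have h := A.jacobiator (S.σ X) u v w
      linear_combination (norm := module) -(1 : ℝ) • h)

theorem op0_derivation (X : VF E M) (u : A.ker) :
    ((S.derivation hA X).op0 u : L0) = A.l2 (S.σ X) u := rfl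

theorem op1_derivation (X : VF E M) (m : L1) :
    (S.derivation hA X).op1 m = A.l2' (S.σ X) m := rfl

theorem form_derivation (X : VF E M) (u v : A.ker) :
    (S.derivation hA X).form u v = A.l3 (S.σ X) u v := rfl

/-- The γ terms cancel here and in `Iγ_eq`, so the morphism depends on `σ` alone. The later
computations use these γ-free forms. -/
theorem Rγ_eq (X Y : VF E M) : S.Rγ X Y = S.σ ⁅X, Y⁆ - A.l2 (S.σ X) (S.σ Y) := by
  simp only [Rγ, R]
  abel

theorem Iγ_eq (X Y Z : VF E M) : S.Iγ X Y Z = -A.l3 (S.σ X) (S.σ Y) (S.σ Z) := by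
  simp only [Iγ, I]
  abel

/-- `(X, Y) ↦ J(X, Y, ·) + R_γ(X, Y)` -/
noncomputable def curvature (X Y : VF E M) : (A.kerBundle hA).DER1 :=
  ({ toFun := fun u => S.J X Y u
     map_add' := fun u v => by
       simp only [J, Submodule.coe_add, map_add]
       abel
     map_smul' := fun f u => by
       simp only [J, Submodule.coe_smul, A.l3_smul, RingHom.id_apply, smul_neg] },
   ⟨S.Rγ X Y, by
     rw [LinearMap.mem_ker, Rγ_eq, map_sub, S.anchor_σ, hA.anchor_l2, S.anchor_σ, S.anchor_σ,
       sub_self]⟩)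

theorem curvature_fst (X Y : VF E M) (u : A.ker) :
    (S.curvature hA X Y).1 u = -A.l3 (S.σ X) (S.σ Y) u := rfl

theorem curvature_snd (X Y : VF E M) :
    ((S.curvature hA X Y).2 : L0) = S.σ ⁅X, Y⁆ - A.l2 (S.σ X) (S.σ Y) := S.Rγ_eq X Y

theorem der1_ext {a b : (A.kerBundle hA).DER1} (h1 : ∀ u, a.1 u = b.1 u)
    (h2 : (a.2 : L0) = b.2) : a = b :=
  Prod.ext (LinearMap.ext h1) (Subtype.ext h2)

theorem curvature_skew (X Y : VF E M) : S.curvature hA X Y = -S.curvature hA Y X := by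
  apply der1_ext
  · intro u
    change -A.l3 (S.σ X) (S.σ Y) u = - -A.l3 (S.σ Y) (S.σ X) u
    rw [A.l3_skew_left]
  · change ((S.curvature hA X Y).2 : L0) = -((S.curvature hA Y X).2 : L0)
    rw [curvature_snd, curvature_snd, A.l2_skew, ← lie_skew, map_neg]
    abel

theorem curvature_add (X X' Y : VF E M) :
    S.curvature hA (X + X') Y = S.curvature hA X Y + S.curvature hA X' Y := by
  apply der1_ext
  · intro u
    simp only [Prod.fst_add, LinearMap.add_apply, curvature_fst, map_add]
    abel
  · simp only [Prod.snd_add, Submodule.coe_add, curvature_snd, map_add, add_lie,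
      LinearMap.add_apply]
    abel

/-- Neither term of R_γ is tensorial: σ[fX, Y] and l_2(fσX, σY) both produce -Y(f)σX, the second
because ρσ = id. The two contributions cancel in the difference. -/
theorem curvature_smul (f : Fn E M) (X Y : VF E M) :
    S.curvature hA (f • X) Y = f • S.curvature hA X Y := by
  apply der1_ext
  · intro u
    simp only [Prod.smul_fst, LinearMap.smul_apply, curvature_fst, map_smul, l3_smul_left, smul_neg]
  · simp only [Prod.smul_snd, Submodule.coe_smul, curvature_snd, map_smul, l2_smul_left,
      S.anchor_σ]
    rw [← lie_skew, vf_lie_smul, ← lie_skew X Y, map_neg, map_add, map_smul, map_smul, map_neg]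
    module

open Lie2AlgebraBundle Lie2AlgebraBundle.Der0

theorem derivation_add (X Y : VF E M) :
    S.derivation hA (X + Y) = S.derivation hA X + S.derivation hA Y := by
  apply Der0.ext
  · rfl
  · intro u
    apply Subtype.ext
    simp only [op0_add, Submodule.coe_add, op0_derivation, map_add, LinearMap.add_apply]
  · intro m
    simp only [op1_add, op1_derivation, map_add, LinearMap.add_apply]
  · intro u v
    simp only [form_add, form_derivation, map_add, LinearMap.add_apply]

/-- The correction term in `l2_smul_left` contains ρ(u), which is zero on ker ρ; hence ∇^0 is
tensorial in X although `l2` is not. -/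
theorem derivation_smul (f : Fn E M) (X : VF E M) :
    S.derivation hA (f • X) = f • S.derivation hA X := by
  apply Der0.ext
  · rfl
  · intro u
    apply Subtype.ext
    simp only [op0_fsmul, Submodule.coe_smul, op0_derivation, map_smul, l2_smul_left,
      LinearMap.mem_ker.mp u.2, map_zero, Derivation.zero_apply, zero_smul, sub_zero]
  · intro m
    simp only [op1_fsmul, op1_derivation, map_smul, A.l2'_smul]
  · intro u v
    simp only [form_fsmul, form_derivation, map_smul, l3_smul_left]

/-- Both δ and ad have symbol zero, so the symbols agree. The remaining three components are
`jacobi`, `jacobi'` and `jacobiator` of `A` with σX and σY in the first two slots. -/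
theorem derivation_lie (X Y : VF E M) :
    S.derivation hA ⁅X, Y⁆ - (S.derivation hA X).bracket (S.derivation hA Y) =
      (A.kerBundle hA).delta (S.curvature hA X Y).1 + (A.kerBundle hA).ad (S.curvature hA X Y).2 := by
  rw [sub_eq_iff_eq_add]
  apply Der0.ext
  · change ⁅X, Y⁆ = 0 + 0 + ⁅X, Y⁆
    simp
  · intro u
    apply Subtype.ext
    simp only [op0_add, op0_bracket, op0_delta, op0_ad]
    change A.l2 (S.σ ⁅X, Y⁆) u = A.l1 (-A.l3 (S.σ X) (S.σ Y) u) + A.l2 (S.Rγ X Y) u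
      + (A.l2 (S.σ X) (A.l2 (S.σ Y) u) - A.l2 (S.σ Y) (A.l2 (S.σ X) u))
    rw [Rγ_eq, map_neg, A.jacobi]
    simp only [map_sub, LinearMap.sub_apply]
    abel
  · intro m
    simp only [op1_add, op1_bracket, op1_delta, op1_ad]
    change A.l2' (S.σ ⁅X, Y⁆) m = -A.l3 (S.σ X) (S.σ Y) (A.l1 m) + A.l2' (S.Rγ X Y) m
      + (A.l2' (S.σ X) (A.l2' (S.σ Y) m) - A.l2' (S.σ Y) (A.l2' (S.σ X) m))
    rw [Rγ_eq, A.jacobi']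
    simp only [map_sub, LinearMap.sub_apply]
    abel
  · intro u v
    simp only [form_add, form_bracket, form_delta, form_ad]
    change A.l3 (S.σ ⁅X, Y⁆) u v = -A.l3 (S.σ X) (S.σ Y) (A.l2 (u : L0) v)
        + A.l2' v (-A.l3 (S.σ X) (S.σ Y) u) - A.l2' u (-A.l3 (S.σ X) (S.σ Y) v)
        + A.l3 (S.Rγ X Y) u v
      + (A.l2' (S.σ X) (A.l3 (S.σ Y) u v) - A.l3 (S.σ Y) (A.l2 (S.σ X) u) v
        - A.l3 (S.σ Y) u (A.l2 (S.σ X) v) + A.l3 (S.σ X) (A.l2 (S.σ Y) u) v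
        + A.l3 (S.σ X) u (A.l2 (S.σ Y) v) - A.l2' (S.σ Y) (A.l3 (S.σ X) u v))
    have h := A.jacobiator (S.σ X) (S.σ Y) u v
    rw [Rγ_eq]
    simp only [map_sub, map_neg, LinearMap.sub_apply]
    linear_combination (norm := module) -(1 : ℝ) • h

/-- The morphism `TM → DER(𝔊)` induced by a splitting of a transitive Lie 2-algebroid. -/
noncomputable def morphism : (tangentLieAlgebroid E M).Morphism (A.kerBundle hA).DER where
  F1 :=
    { toFun := S.derivation hA
      map_add' := S.derivation_add hA
      map_smul' := S.derivation_smul hA }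
  F2 := LinearMap.mk₂ (Fn E M) (S.curvature hA) (S.curvature_add hA) (S.curvature_smul hA)
    (fun X Y Y' => by
      rw [curvature_skew, curvature_add, S.curvature_skew hA X Y, S.curvature_skew hA X Y', neg_add])
    (fun f X Y => by
      rw [curvature_skew, curvature_smul, S.curvature_skew hA X Y, smul_neg])
  F3 := LinearMap.mk₂ (Fn E M)
    (fun X Y =>
      { toFun := fun Z => -A.l3 (S.σ X) (S.σ Y) (S.σ Z)
        map_add' := fun Z Z' => by simp only [map_add, neg_add]
        map_smul' := fun f Z => by simp only [map_smul, A.l3_smul, smul_neg, RingHom.id_apply] })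
    (fun X X' Y => LinearMap.ext fun Z => by
      simp only [LinearMap.coe_mk, AddHom.coe_mk, LinearMap.add_apply, map_add, neg_add])
    (fun f X Y => LinearMap.ext fun Z => by
      simp only [LinearMap.coe_mk, AddHom.coe_mk, LinearMap.smul_apply, map_smul, l3_smul_left,
        smul_neg])
    (fun X Y Y' => LinearMap.ext fun Z => by
      simp only [LinearMap.coe_mk, AddHom.coe_mk, LinearMap.add_apply, map_add, neg_add])
    (fun f X Y => LinearMap.ext fun Z => by
      simp only [LinearMap.coe_mk, AddHom.coe_mk, LinearMap.smul_apply, map_smul, l3_smul_mid,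
        smul_neg])
  F2_skew := S.curvature_skew hA
  F3_skew_left X Y Z := congrArg Neg.neg (A.l3_skew_left _ _ _)
  F3_skew_right X Y Z := congrArg Neg.neg (A.l3_skew_right _ _ _)
  anchor_F1 X := rfl
  eq2 := S.derivation_lie hA
  eq3 X Y Z := by
    apply der1_ext
    · intro u
      change ((A.l2' (S.σ X) (-A.l3 (S.σ Y) (S.σ Z) u) - -A.l3 (S.σ Y) (S.σ Z) (A.l2 (S.σ X) u)
          + A.l3 (S.σ X) (S.Rγ Y Z) u) - -A.l3 (S.σ ⁅X, Y⁆) (S.σ Z) u)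
        + ((A.l2' (S.σ Y) (-A.l3 (S.σ Z) (S.σ X) u) - -A.l3 (S.σ Z) (S.σ X) (A.l2 (S.σ Y) u)
          + A.l3 (S.σ Y) (S.Rγ Z X) u) - -A.l3 (S.σ ⁅Y, Z⁆) (S.σ X) u)
        + ((A.l2' (S.σ Z) (-A.l3 (S.σ X) (S.σ Y) u) - -A.l3 (S.σ X) (S.σ Y) (A.l2 (S.σ Z) u)
          + A.l3 (S.σ Z) (S.Rγ X Y) u) - -A.l3 (S.σ ⁅Z, X⁆) (S.σ Y) u) =
        A.l2' u (-A.l3 (S.σ X) (S.σ Y) (S.σ Z))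
      -- Each l_3(σX, σ[Y,Z], u) coming from R_γ cancels the term J([Y,Z], X, u). What survives is
      -- the coherence law of `A`, once the cyclic arrangement is sorted by skew-symmetry.
      have h := A.jacobiator (S.σ X) (S.σ Y) (S.σ Z) u
      simp only [Rγ_eq, map_sub, map_neg, LinearMap.sub_apply]
      rw [A.l2_skew (S.σ Z) (S.σ X), A.l3_skew_left (S.σ Z) (S.σ X), A.l3_skew_left (S.σ Z) (S.σ X),
        A.l3_skew_left (S.σ X) (S.σ ⁅Y, Z⁆), A.l3_skew_left (S.σ Y) (S.σ ⁅Z, X⁆),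
        A.l3_skew_left (S.σ Z) (S.σ ⁅X, Y⁆), A.l3_skew_left (S.σ Z) (A.l2 (S.σ X) (S.σ Y))]
      simp only [map_neg, LinearMap.neg_apply]
      linear_combination (norm := module) -(1 : ℝ) • h
    · change (A.l2 (S.σ X) (S.Rγ Y Z) - S.Rγ ⁅X, Y⁆ Z) + (A.l2 (S.σ Y) (S.Rγ Z X) - S.Rγ ⁅Y, Z⁆ X)
        + (A.l2 (S.σ Z) (S.Rγ X Y) - S.Rγ ⁅Z, X⁆ Y) = A.l1 (-A.l3 (S.σ X) (S.σ Y) (S.σ Z))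
      -- Two Jacobi identities meet here: the one for vector fields removes the terms σ[[X,Y],Z],
      -- and the one for `A` turns the nested `l2` terms into l_1 l_3. The mixed terms l_2(σX,
      -- σ[Y,Z]) cancel in pairs.
      have h := congrArg S.σ (lie_jacobi X Y Z)
      rw [← lie_skew X ⁅Y, Z⁆, ← lie_skew Y ⁅Z, X⁆, ← lie_skew Z ⁅X, Y⁆] at h
      simp only [map_add, map_neg, map_zero] at h
      rw [map_neg, A.jacobi]
      simp only [Rγ_eq, map_sub]
      rw [A.l2_skew (S.σ ⁅X, Y⁆), A.l2_skew (S.σ ⁅Y, Z⁆), A.l2_skew (S.σ ⁅Z, X⁆),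
        A.l2_skew (S.σ Z) (S.σ X), A.l2_skew (S.σ Z) (A.l2 _ _)]
      simp only [map_neg]
      linear_combination (norm := module) h
  eq4 X₁ X₂ X₃ X₄ := by
    change (A.l2' (S.σ X₁) (-A.l3 (S.σ X₂) (S.σ X₃) (S.σ X₄))
        - A.l2' (S.σ X₂) (-A.l3 (S.σ X₁) (S.σ X₃) (S.σ X₄))
        + A.l2' (S.σ X₃) (-A.l3 (S.σ X₁) (S.σ X₂) (S.σ X₄))
        - A.l2' (S.σ X₄) (-A.l3 (S.σ X₁) (S.σ X₂) (S.σ X₃)))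
      + (-(-A.l3 (S.σ ⁅X₁, X₂⁆) (S.σ X₃) (S.σ X₄) - (1 / 2 : ℝ) •
            (-A.l3 (S.σ X₁) (S.σ X₂) (S.Rγ X₃ X₄) + -A.l3 (S.σ X₃) (S.σ X₄) (S.Rγ X₁ X₂)))
        + (-A.l3 (S.σ ⁅X₁, X₃⁆) (S.σ X₂) (S.σ X₄) - (1 / 2 : ℝ) •
            (-A.l3 (S.σ X₁) (S.σ X₃) (S.Rγ X₂ X₄) + -A.l3 (S.σ X₂) (S.σ X₄) (S.Rγ X₁ X₃)))
        - (-A.l3 (S.σ ⁅X₁, X₄⁆) (S.σ X₂) (S.σ X₃) - (1 / 2 : ℝ) •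
            (-A.l3 (S.σ X₁) (S.σ X₄) (S.Rγ X₂ X₃) + -A.l3 (S.σ X₂) (S.σ X₃) (S.Rγ X₁ X₄)))
        - (-A.l3 (S.σ ⁅X₂, X₃⁆) (S.σ X₁) (S.σ X₄) - (1 / 2 : ℝ) •
            (-A.l3 (S.σ X₂) (S.σ X₃) (S.Rγ X₁ X₄) + -A.l3 (S.σ X₁) (S.σ X₄) (S.Rγ X₂ X₃)))
        + (-A.l3 (S.σ ⁅X₂, X₄⁆) (S.σ X₁) (S.σ X₃) - (1 / 2 : ℝ) •
            (-A.l3 (S.σ X₂) (S.σ X₄) (S.Rγ X₁ X₃) + -A.l3 (S.σ X₁) (S.σ X₃) (S.Rγ X₂ X₄)))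
        - (-A.l3 (S.σ ⁅X₃, X₄⁆) (S.σ X₁) (S.σ X₂) - (1 / 2 : ℝ) •
            (-A.l3 (S.σ X₃) (S.σ X₄) (S.Rγ X₁ X₂) + -A.l3 (S.σ X₁) (S.σ X₂) (S.Rγ X₃ X₄)))) = 0
    -- Each pairing of F^2(X_i,X_j) with F^2(X_k,X_l) occurs twice with the same sign, which absorbs
    -- the factor 1/2. The σ[·,·] part of R_γ then cancels the F^3([·,·],·,·) terms, and its `l2`
    -- part supplies the `l3 (l2 ..)` terms of the coherence law.
    have h := A.jacobiator (S.σ X₁) (S.σ X₂) (S.σ X₃) (S.σ X₄)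
    have hl : ∀ X Y Z W : VF E M,
        A.l3 (S.σ ⁅X, Y⁆) (S.σ Z) (S.σ W) = A.l3 (S.σ Z) (S.σ W) (S.σ ⁅X, Y⁆) :=
      fun X Y Z W => l3_rotate _ _ _
    -- The inner brackets go to the last slot, where the pairing places R_γ.
    rw [l3_rotate (A.l2 (S.σ X₁) (S.σ X₂)), A.l3_skew_right _ (A.l2 (S.σ X₁) (S.σ X₃)),
      A.l3_skew_right _ (A.l2 (S.σ X₂) (S.σ X₃))] at h
    simp only [Rγ_eq, map_sub, map_neg, hl]
    linear_combination (norm := module) -(1 : ℝ) • h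

end Splitting
end Lie2Algebroid
end SplittingMorphism

/-! ### The coherence law on a direct sum of two modules. -/

section Jacobiator

variable {P Q V1 : Type*} [AddCommGroup P] [Module ℝ P] [AddCommGroup Q] [Module ℝ Q]
  [AddCommGroup V1] [Module ℝ V1]

/-- The left-hand side of the coherence law of a Lie 2-algebra. -/
noncomputable def jacobiatorDefect {V0 : Type*} [AddCommGroup V0] [Module ℝ V0]
    (l2 : V0 →ₗ[ℝ] V0 →ₗ[ℝ] V0) (l2' : V0 →ₗ[ℝ] V1 →ₗ[ℝ] V1)
    (l3 : V0 →ₗ[ℝ] V0 →ₗ[ℝ] V0 →ₗ[ℝ] V1) (w x y z : V0) : V1 :=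
  l2' w (l3 x y z) - l2' x (l3 w y z) + l2' y (l3 w x z) - l2' z (l3 w x y)
    - l3 (l2 w x) y z - l3 x (l2 w y) z - l3 x y (l2 w z)
    + l3 w (l2 x y) z + l3 w y (l2 x z) - l3 w x (l2 y z)

/-- The coherence law on a direct sum, by multilinearity and skew-symmetry. -/
theorem jacobiatorDefect_eq_zero (l2 : P × Q →ₗ[ℝ] P × Q →ₗ[ℝ] P × Q)
    (l2' : P × Q →ₗ[ℝ] V1 →ₗ[ℝ] V1) (l3 : P × Q →ₗ[ℝ] P × Q →ₗ[ℝ] P × Q →ₗ[ℝ] V1)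
    (l2_skew : ∀ x y, l2 x y = -l2 y x) (l3_skew_left : ∀ x y z, l3 x y z = -l3 y x z)
    (l3_skew_right : ∀ x y z, l3 x y z = -l3 x z y)
    (h4 : ∀ X Y Z W, jacobiatorDefect l2 l2' l3 (X, 0) (Y, 0) (Z, 0) (W, 0) = 0)
    (h3 : ∀ X Y Z u, jacobiatorDefect l2 l2' l3 (X, 0) (Y, 0) (Z, 0) (0, u) = 0)
    (h2 : ∀ X Y u v, jacobiatorDefect l2 l2' l3 (X, 0) (Y, 0) (0, u) (0, v) = 0)
    (h1 : ∀ X u v w, jacobiatorDefect l2 l2' l3 (X, 0) (0, u) (0, v) (0, w) = 0)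
    (h0 : ∀ u v w z, jacobiatorDefect l2 l2' l3 (0, u) (0, v) (0, w) (0, z) = 0)
    (w x y z : P × Q) : jacobiatorDefect l2 l2' l3 w x y z = 0 := by
  -- The three adjacent transpositions generate all permutations, so the defect is totally skew.
  -- Additivity is therefore needed in the first slot only.
  have sw : ∀ w x y z, jacobiatorDefect l2 l2' l3 w x y z = -jacobiatorDefect l2 l2' l3 x w y z := by
    intro w x y z
    simp only [jacobiatorDefect]
    have h3' : ∀ t, l3 x w t = -l3 w x t := l3_skew_left x w
    simp only [h3', l2_skew x w, map_neg, LinearMap.neg_apply]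
    abel
  have sx : ∀ w x y z, jacobiatorDefect l2 l2' l3 w x y z = -jacobiatorDefect l2 l2' l3 w y x z := by
    intro w x y z
    simp only [jacobiatorDefect]
    have h3' : ∀ t, l3 y x t = -l3 x y t := l3_skew_left y x
    simp only [h3', l2_skew y x, l3_skew_right w y x, l3_skew_left (l2 w y) x,
      l3_skew_left y (l2 w x), map_neg, LinearMap.neg_apply]
    abel
  have sy : ∀ w x y z, jacobiatorDefect l2 l2' l3 w x y z = -jacobiatorDefect l2 l2' l3 w x z y := by
    intro w x y z
    simp only [jacobiatorDefect]
    have h3' : ∀ t, l3 t z y = -l3 t y z := fun t => l3_skew_right t z y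
    simp only [h3', l2_skew z y, l3_skew_right x (l2 w z) y, l3_skew_right x z (l2 w y),
      l3_skew_right w (l2 x z) y, l3_skew_right w z (l2 x y), map_neg]
    abel
  have add : ∀ a b x y z, jacobiatorDefect l2 l2' l3 (a + b) x y z =
      jacobiatorDefect l2 l2' l3 a x y z + jacobiatorDefect l2 l2' l3 b x y z := by
    intro a b x y z
    simp only [jacobiatorDefect, map_add, LinearMap.add_apply]
    abel
  have ind : ∀ x y z, (∀ X, jacobiatorDefect l2 l2' l3 (X, 0) x y z = 0) →
      (∀ u, jacobiatorDefect l2 l2' l3 (0, u) x y z = 0) →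
      ∀ w, jacobiatorDefect l2 l2' l3 w x y z = 0 := by
    rintro x y z hX hu ⟨X, u⟩
    rw [← zero_add u, ← add_zero X, ← Prod.mk_add_mk, add, hX, hu, add_zero]
  -- Oriented as rewrite rules, these perform a bubble sort that moves the `P` arguments in front of
  -- the `Q` arguments.
  have sw' : ∀ u X y z, jacobiatorDefect l2 l2' l3 (0, u) (X, 0) y z =
      -jacobiatorDefect l2 l2' l3 (X, 0) (0, u) y z := fun u X => sw _ _
  have sx' : ∀ w u X z, jacobiatorDefect l2 l2' l3 w (0, u) (X, 0) z =
      -jacobiatorDefect l2 l2' l3 w (X, 0) (0, u) z := fun w u X => sx _ _ _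
  have sy' : ∀ w x u X, jacobiatorDefect l2 l2' l3 w x (0, u) (X, 0) =
      -jacobiatorDefect l2 l2' l3 w x (X, 0) (0, u) := fun w x u X => sy _ _ _ _
  -- Each round splits the first slot into its two pure parts and then brings the next unsplit
  -- argument to the front. The sixteen resulting cases sort into the five hypotheses.
  revert w
  refine ind x y z (fun A => ?_) (fun a => ?_) <;> rw [sw, neg_eq_zero] <;> revert x <;>
  refine ind _ y z (fun B => ?_) (fun b => ?_) <;> rw [sx, sw, neg_neg] <;> revert y <;>
  refine ind _ _ z (fun C => ?_) (fun c => ?_) <;> rw [sy, sx, sw, neg_neg, neg_eq_zero] <;>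
  revert z <;> refine ind _ _ _ (fun D => ?_) (fun d => ?_) <;>
  simp only [sw', sx', sy', h0, h1, h2, h3, h4, neg_zero]

end Jacobiator

/-! ### Brackets on TM ⊕ 𝒢_0 assembled from a morphism, and their Jacobi identities. -/

section SplitForm

variable {E M : Type*} [NormedAddCommGroup E] [NormedSpace ℝ E] [FiniteDimensional ℝ E]
  [TopologicalSpace M] [ChartedSpace E M] [IsManifold 𝓘(ℝ, E) ∞ M]
  {G0 G1 : Type*}
  [AddCommGroup G0] [Module ℝ G0] [Module (Fn E M) G0] [IsScalarTower ℝ (Fn E M) G0]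
  [AddCommGroup G1] [Module ℝ G1] [Module (Fn E M) G1] [IsScalarTower ℝ (Fn E M) G1]

namespace Lie2AlgebraBundle

open Der0

variable {𝔊 : Lie2AlgebraBundle E M G0 G1} (F : (tangentLieAlgebroid E M).Morphism 𝔊.DER)

theorem symbol_F1 (X : VF E M) : (F.F1 X).symbol = X := F.anchor_F1 X

/-- Solving `eq2` for F^1([X,Y]) lets its components eliminate the operators at a bracket:
`op0_F1_lie` serves `splitTernary_jacobi`, `op1_F1_lie` serves `splitTernary_l1`, and `form_F1_lie`
serves the coherence law with two vector fields. -/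
theorem F1_lie (X Y : VF E M) : F.F1 ⁅X, Y⁆ =
    𝔊.delta (F.F2 X Y).1 + 𝔊.ad (F.F2 X Y).2 + (F.F1 X).bracket (F.F1 Y) :=
  sub_eq_iff_eq_add.mp (F.eq2 X Y)

theorem op0_F1_lie (X Y : VF E M) (u : G0) : (F.F1 ⁅X, Y⁆).op0 u =
    𝔊.l1 ((F.F2 X Y).1 u) + 𝔊.l2 (F.F2 X Y).2 u
      + ((F.F1 X).op0 ((F.F1 Y).op0 u) - (F.F1 Y).op0 ((F.F1 X).op0 u)) := by
  rw [F1_lie]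
  rfl

theorem op1_F1_lie (X Y : VF E M) (m : G1) : (F.F1 ⁅X, Y⁆).op1 m =
    (F.F2 X Y).1 (𝔊.l1 m) + 𝔊.l2' (F.F2 X Y).2 m
      + ((F.F1 X).op1 ((F.F1 Y).op1 m) - (F.F1 Y).op1 ((F.F1 X).op1 m)) := by
  rw [F1_lie]
  rfl

theorem form_F1_lie (X Y : VF E M) (u v : G0) : (F.F1 ⁅X, Y⁆).form u v =
    (F.F2 X Y).1 (𝔊.l2 u v) + 𝔊.l2' v ((F.F2 X Y).1 u) - 𝔊.l2' u ((F.F2 X Y).1 v)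
      + 𝔊.l3 (F.F2 X Y).2 u v
      + ((F.F1 X).op1 ((F.F1 Y).form u v) - (F.F1 Y).form ((F.F1 X).op0 u) v
        - (F.F1 Y).form u ((F.F1 X).op0 v) + (F.F1 X).form ((F.F1 Y).op0 u) v
        + (F.F1 X).form u ((F.F1 Y).op0 v) - (F.F1 Y).op1 ((F.F1 X).form u v)) := by
  rw [F1_lie]
  rfl

theorem op0_F2_cyclic (X Y Z : VF E M) :
    ((F.F1 X).op0 (F.F2 Y Z).2 - (F.F2 ⁅X, Y⁆ Z).2)
      + ((F.F1 Y).op0 (F.F2 Z X).2 - (F.F2 ⁅Y, Z⁆ X).2)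
      + ((F.F1 Z).op0 (F.F2 X Y).2 - (F.F2 ⁅Z, X⁆ Y).2) = 𝔊.l1 (F.F3 X Y Z) :=
  congrArg Prod.snd (F.eq3 X Y Z)

theorem op1_F2_cyclic (X Y Z : VF E M) (u : G0) :
    ((F.F1 X).op1 ((F.F2 Y Z).1 u) - (F.F2 Y Z).1 ((F.F1 X).op0 u)
        + (F.F1 X).form (F.F2 Y Z).2 u - (F.F2 ⁅X, Y⁆ Z).1 u)
      + ((F.F1 Y).op1 ((F.F2 Z X).1 u) - (F.F2 Z X).1 ((F.F1 Y).op0 u)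
        + (F.F1 Y).form (F.F2 Z X).2 u - (F.F2 ⁅Y, Z⁆ X).1 u)
      + ((F.F1 Z).op1 ((F.F2 X Y).1 u) - (F.F2 X Y).1 ((F.F1 Z).op0 u)
        + (F.F1 Z).form (F.F2 X Y).2 u - (F.F2 ⁅Z, X⁆ Y).1 u) = 𝔊.l2' u (F.F3 X Y Z) :=
  congrArg (fun a : 𝔊.DER1 => a.1 u) (F.eq3 X Y Z)

/-- The form of `eq4` without the factor 1/2: complementary index pairs carry equal signs and the
pairing on degree -1 is symmetric, so the six half terms combine into three. -/
theorem F3_coherence (X Y Z W : VF E M) :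
    (F.F1 X).op1 (F.F3 Y Z W) - (F.F1 Y).op1 (F.F3 X Z W) + (F.F1 Z).op1 (F.F3 X Y W)
      - (F.F1 W).op1 (F.F3 X Y Z)
      - F.F3 ⁅X, Y⁆ Z W + F.F3 ⁅X, Z⁆ Y W - F.F3 ⁅X, W⁆ Y Z - F.F3 ⁅Y, Z⁆ X W + F.F3 ⁅Y, W⁆ X Z
      - F.F3 ⁅Z, W⁆ X Y
      + ((F.F2 X Y).1 (F.F2 Z W).2 + (F.F2 Z W).1 (F.F2 X Y).2)
      - ((F.F2 X Z).1 (F.F2 Y W).2 + (F.F2 Y W).1 (F.F2 X Z).2)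
      + ((F.F2 X W).1 (F.F2 Y Z).2 + (F.F2 Y Z).1 (F.F2 X W).2) = 0 := by
  have b11 : ∀ a b : 𝔊.DER1, 𝔊.DER.b11 a b = a.1 b.2 + b.1 a.2 := fun _ _ => rfl
  have b02 : ∀ (D : 𝔊.Der0) (m : G1), 𝔊.DER.b02 D m = D.op1 m := fun _ _ => rfl
  have br : ∀ X Y : VF E M, (tangentLieAlgebroid E M).bracket X Y = ⁅X, Y⁆ := fun _ _ => rfl
  have h := F.eq4 X Y Z W
  simp only [b11, b02, br] at h
  linear_combination (norm := module) h

/-- `(X + u, Y + v) ↦ [X, Y] - R_γ(X, Y) + ∇^0_X v - ∇^0_Y u + 𝔩_2(u, v)` -/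
noncomputable def splitBracket (x y : VF E M × G0) : VF E M × G0 :=
  (⁅x.1, y.1⁆, -(F.F2 x.1 y.1).2 + (F.F1 x.1).op0 y.2 - (F.F1 y.1).op0 x.2 + 𝔊.l2 x.2 y.2)

/-- `(X + u, m) ↦ ∇^1_X m + 𝔩_2(u, m)` -/
noncomputable def splitAction (x : VF E M × G0) (m : G1) : G1 := (F.F1 x.1).op1 m + 𝔊.l2' x.2 m

/-- The ternary bracket on `TM ⊕ 𝒢_0` assembled from `I_γ`, `J`, `K` and `𝔩_3`. -/
noncomputable def splitTernary (x y z : VF E M × G0) : G1 :=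
  -F.F3 x.1 y.1 z.1 - (F.F2 x.1 y.1).1 z.2 + (F.F2 x.1 z.1).1 y.2 - (F.F2 y.1 z.1).1 x.2
    + (F.F1 x.1).form y.2 z.2 - (F.F1 y.1).form x.2 z.2 + (F.F1 z.1).form x.2 y.2
    + 𝔊.l3 x.2 y.2 z.2

theorem F2_fst_skew (X Y : VF E M) (u : G0) : (F.F2 X Y).1 u = -(F.F2 Y X).1 u := by
  rw [F.F2_skew]
  rfl

theorem F2_snd_skew (X Y : VF E M) : (F.F2 X Y).2 = -(F.F2 Y X).2 := by
  rw [F.F2_skew]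
  rfl

theorem splitBracket_skew (x y : VF E M × G0) : splitBracket F x y = -splitBracket F y x := by
  refine Prod.ext (lie_skew _ _).symm ?_
  simp only [splitBracket, Prod.snd_neg]
  rw [F2_snd_skew, 𝔊.l2_skew]
  abel

theorem splitBracket_add_left (x x' y : VF E M × G0) :
    splitBracket F (x + x') y = splitBracket F x y + splitBracket F x' y := by
  refine Prod.ext (add_lie _ _ _) ?_
  simp only [splitBracket, Prod.snd_add, Prod.fst_add, map_add, LinearMap.add_apply, op0_add]
  abel

theorem splitBracket_rsmul_left (c : ℝ) (x y : VF E M × G0) :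
    splitBracket F (c • x) y = c • splitBracket F x y := by
  refine Prod.ext (smul_lie _ _ _) ?_
  simp only [splitBracket, Prod.smul_snd, Prod.smul_fst, map_smul, LinearMap.map_smul_of_tower,
    LinearMap.smul_apply, op0_rsmul]
  module

/-- In the 𝒢_0 component the derivative term comes from the symbol of F^1(X), which is X by
`symbol_F1`; it thus matches the one in the TM component. -/
theorem splitBracket_fsmul_right (x : VF E M × G0) (f : Fn E M) (y : VF E M × G0) :
    splitBracket F x (f • y) = f • splitBracket F x y + vfDer x.1 f • y := by
  refine Prod.ext (vf_lie_smul _ _ _) ?_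
  simp only [splitBracket, Prod.smul_snd, Prod.smul_fst, map_smul, Prod.snd_add, op0_smul,
    op0_fsmul, symbol_F1, 𝔊.l2_smul]
  module

theorem splitTernary_skew_left (x y z : VF E M × G0) :
    splitTernary F x y z = -splitTernary F y x z := by
  simp only [splitTernary]
  rw [F.F3_skew_left, F2_fst_skew F x.1 y.1, (F.F1 z.1).form_skew x.2, 𝔊.l3_skew_left]
  abel

theorem splitTernary_skew_right (x y z : VF E M × G0) :
    splitTernary F x y z = -splitTernary F x z y := by
  simp only [splitTernary]
  rw [F.F3_skew_right, F2_fst_skew F y.1 z.1, (F.F1 x.1).form_skew y.2, 𝔊.l3_skew_right]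
  abel

theorem splitTernary_add_right (x y z z' : VF E M × G0) :
    splitTernary F x y (z + z') = splitTernary F x y z + splitTernary F x y z' := by
  simp only [splitTernary, Prod.snd_add, Prod.fst_add, map_add, LinearMap.add_apply, form_add]
  abel

theorem splitTernary_fsmul_right (x y : VF E M × G0) (f : Fn E M) (z : VF E M × G0) :
    splitTernary F x y (f • z) = f • splitTernary F x y z := by
  simp only [splitTernary, Prod.smul_snd, Prod.smul_fst, map_smul, LinearMap.smul_apply,
    form_fsmul, 𝔊.l3_smul]
  module

theorem splitTernary_rsmul_right (x y : VF E M × G0) (c : ℝ) (z : VF E M × G0) :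
    splitTernary F x y (c • z) = c • splitTernary F x y z := by
  simp only [splitTernary, Prod.smul_snd, Prod.smul_fst, map_smul, LinearMap.map_smul_of_tower,
    LinearMap.smul_apply, form_rsmul]
  module

/-- `splitBracket` as a bilinear map. -/
noncomputable def splitBracketₗ : VF E M × G0 →ₗ[ℝ] VF E M × G0 →ₗ[ℝ] VF E M × G0 :=
  LinearMap.mk₂ ℝ (splitBracket F) (splitBracket_add_left F) (splitBracket_rsmul_left F)
    (fun x y y' => by
      rw [splitBracket_skew, splitBracket_add_left, splitBracket_skew F x y,
        splitBracket_skew F x y', neg_add])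
    (fun c x y => by
      rw [splitBracket_skew, splitBracket_rsmul_left, splitBracket_skew F x y, smul_neg])

/-- `splitAction` as a bilinear map. -/
noncomputable def splitActionₗ : VF E M × G0 →ₗ[ℝ] G1 →ₗ[ℝ] G1 :=
  LinearMap.mk₂ ℝ (splitAction F)
    (fun x x' m => by
      simp only [splitAction, Prod.snd_add, Prod.fst_add, map_add, LinearMap.add_apply, op1_add]
      abel)
    (fun c x m => by
      simp only [splitAction, Prod.smul_snd, Prod.smul_fst, map_smul, LinearMap.map_smul_of_tower,
        LinearMap.smul_apply, op1_rsmul, smul_add])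
    (fun x m n => by
      simp only [splitAction, map_add]
      abel)
    (fun c x m => by
      simp only [splitAction, map_smul, smul_add])

/-- `splitTernary` as a trilinear map. -/
noncomputable def splitTernaryₗ : VF E M × G0 →ₗ[ℝ] VF E M × G0 →ₗ[ℝ] VF E M × G0 →ₗ[ℝ] G1 :=
  LinearMap.mk₂ ℝ
    (fun x y =>
      { toFun := splitTernary F x y
        map_add' := splitTernary_add_right F x y
        map_smul' := splitTernary_rsmul_right F x y })
    (fun x x' y => LinearMap.ext fun z => by
      change splitTernary F (x + x') y z = splitTernary F x y z + splitTernary F x' y z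
      -- Two transpositions carry the varying argument to the last slot, where additivity is known.
      simp only [splitTernary_skew_left F _ y, splitTernary_skew_right F y _ z,
        splitTernary_add_right]
      abel)
    (fun c x y => LinearMap.ext fun z => by
      change splitTernary F (c • x) y z = c • splitTernary F x y z
      simp only [splitTernary_skew_left F _ y, splitTernary_skew_right F y _ z,
        splitTernary_rsmul_right]
      module)
    (fun x y y' => LinearMap.ext fun z => by
      change splitTernary F x (y + y') z = splitTernary F x y z + splitTernary F x y' z
      simp only [splitTernary_skew_right F x _ z, splitTernary_add_right]
      abel)
    (fun c x y => LinearMap.ext fun z => by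
      change splitTernary F x (c • y) z = c • splitTernary F x y z
      simp only [splitTernary_skew_right F x _ z, splitTernary_rsmul_right]
      module)

/-- The TM component is the Jacobi identity of vector fields. The 𝒢_0 component gathers, for three,
two, one and no vector fields, `op0_F2_cyclic`, `op0_F1_lie`, `op0_l2` and the Jacobi law of 𝔊. -/
theorem splitTernary_jacobi (x y z : VF E M × G0) :
    ((0, 𝔊.l1 (splitTernary F x y z)) : VF E M × G0) =
      splitBracket F x (splitBracket F y z) - splitBracket F (splitBracket F x y) z
        - splitBracket F y (splitBracket F x z) := by
  obtain ⟨X, u⟩ := x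
  obtain ⟨Y, v⟩ := y
  obtain ⟨Z, w⟩ := z
  refine Prod.ext ?_ ?_
  · change 0 = ⁅X, ⁅Y, Z⁆⁆ - ⁅⁅X, Y⁆, Z⁆ - ⁅Y, ⁅X, Z⁆⁆
    rw [leibniz_lie X Y Z]
    abel
  · have h := op0_F2_cyclic F X Y Z
    -- The cyclic identity is rewritten with the argument order in which F^2 occurs in the nested
    -- brackets.
    have e1 : (F.F2 ⁅Y, Z⁆ X).2 = -(F.F2 X ⁅Y, Z⁆).2 := F2_snd_skew F _ _
    have e2 : (F.F2 ⁅Z, X⁆ Y).2 = (F.F2 Y ⁅X, Z⁆).2 := by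
      rw [F2_snd_skew, ← lie_skew Z X, map_neg, Prod.snd_neg, neg_neg]
    rw [F2_snd_skew F Z X, e1, e2] at h
    simp only [splitTernary, splitBracket, Prod.snd_sub, op0_F1_lie, op0_l2, map_add, map_sub,
      map_neg, LinearMap.add_apply, LinearMap.sub_apply, LinearMap.neg_apply, 𝔊.jacobi] at h ⊢
    rw [𝔊.l2_skew u (F.F2 Y Z).2, 𝔊.l2_skew v (F.F2 X Z).2, 𝔊.l2_skew v ((F.F1 Z).op0 u)]
    linear_combination (norm := module) h

/-- As the last argument has no vector part, only J(X,Y,·), two K terms and 𝔩_3 survive on the left.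
They are accounted for by `op1_F1_lie`, by `op1_l2'` for X and for Y, and by `jacobi'` of 𝔊. -/
theorem splitTernary_l1 (x y : VF E M × G0) (m : G1) :
    splitTernary F x y (0, 𝔊.l1 m) =
      splitAction F x (splitAction F y m) - splitAction F (splitBracket F x y) m
        - splitAction F y (splitAction F x m) := by
  obtain ⟨X, u⟩ := x
  obtain ⟨Y, v⟩ := y
  simp only [splitTernary, splitAction, splitBracket, map_zero, op1_F1_lie, op1_l2', map_add,
    map_sub, map_neg, LinearMap.add_apply, LinearMap.sub_apply, LinearMap.neg_apply,
    LinearMap.zero_apply, form_zero, Prod.fst_zero, 𝔊.jacobi']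
  abel

end Lie2AlgebraBundle
end SplitForm

/-! ### The coherence law and the assembled Lie 2-algebroid. -/

section SplitFormAlgebroid

variable {E M : Type*} [NormedAddCommGroup E] [NormedSpace ℝ E] [FiniteDimensional ℝ E]
  [TopologicalSpace M] [ChartedSpace E M] [IsManifold 𝓘(ℝ, E) ∞ M]
  {G0 G1 : Type*}
  [AddCommGroup G0] [Module ℝ G0] [Module (Fn E M) G0] [IsScalarTower ℝ (Fn E M) G0]
  [AddCommGroup G1] [Module ℝ G1] [Module (Fn E M) G1] [IsScalarTower ℝ (Fn E M) G1]

namespace Lie2AlgebraBundle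

open Der0

variable {𝔊 : Lie2AlgebraBundle E M G0 G1} (F : (tangentLieAlgebroid E M).Morphism 𝔊.DER)

theorem splitBracketₗ_apply (X Y : VF E M) (u v : G0) : splitBracketₗ F (X, u) (Y, v) =
    (⁅X, Y⁆, -(F.F2 X Y).2 + (F.F1 X).op0 v - (F.F1 Y).op0 u + 𝔊.l2 u v) := rfl

theorem splitActionₗ_apply (X : VF E M) (u : G0) (m : G1) :
    splitActionₗ F (X, u) m = (F.F1 X).op1 m + 𝔊.l2' u m := rfl

theorem splitTernaryₗ_apply (X Y Z : VF E M) (u v w : G0) :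
    splitTernaryₗ F (X, u) (Y, v) (Z, w) =
      -F.F3 X Y Z - (F.F2 X Y).1 w + (F.F2 X Z).1 v - (F.F2 Y Z).1 u
        + (F.F1 X).form v w - (F.F1 Y).form u w + (F.F1 Z).form u v + 𝔊.l3 u v w := rfl

theorem F3_rotate (X Y Z : VF E M) : F.F3 X Y Z = F.F3 Y Z X := by
  rw [F.F3_skew_left, F.F3_skew_right, neg_neg]

/-- On pure arguments with four, three, two, one and no vector fields, the law is respectively
`eq4`, the Hom component of `eq3`, the 2-form component of `eq2`, the compatibility of F^1(X) with
𝔩_3, and the coherence law of 𝔊. -/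
theorem splitTernary_jacobiator (w x y z : VF E M × G0) :
    jacobiatorDefect (splitBracketₗ F) (splitActionₗ F) (splitTernaryₗ F) w x y z = 0 := by
  apply jacobiatorDefect_eq_zero
  · exact splitBracket_skew F
  · exact splitTernary_skew_left F
  · exact splitTernary_skew_right F
  · intro X Y Z W
    have h := F3_coherence F X Y Z W
    simp only [jacobiatorDefect, splitBracketₗ_apply, splitActionₗ_apply, splitTernaryₗ_apply,
      map_zero, LinearMap.zero_apply, add_zero, sub_zero, map_neg, neg_zero]
    -- The inner brackets go to the first slot, as in `F3_coherence`.
    rw [F.F3_skew_left Y ⁅X, Z⁆, ← F3_rotate F ⁅X, W⁆, F.F3_skew_left X ⁅Y, Z⁆,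
      ← F3_rotate F ⁅Y, W⁆, ← F3_rotate F ⁅Z, W⁆]
    linear_combination (norm := module) -(1 : ℝ) • h
  · intro X Y Z u
    have h := op1_F2_cyclic F X Y Z u
    have e1 : (F.F2 ⁅Y, Z⁆ X).1 u = -(F.F2 X ⁅Y, Z⁆).1 u := F2_fst_skew F _ _ u
    have e2 : (F.F2 ⁅Z, X⁆ Y).1 u = (F.F2 Y ⁅X, Z⁆).1 u := by
      rw [F2_fst_skew, ← lie_skew Z X, map_neg, Prod.fst_neg, LinearMap.neg_apply, neg_neg]
    simp only [F2_fst_skew F Z X, F2_snd_skew F Z X, e1, e2, map_neg, LinearMap.neg_apply] at h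
    simp only [jacobiatorDefect, splitBracketₗ_apply, splitActionₗ_apply, splitTernaryₗ_apply,
      map_zero, LinearMap.zero_apply, add_zero, sub_zero, map_neg, zero_add, Prod.fst_zero, Prod.snd_zero, lie_zero, zero_sub,
      op1_zero, neg_zero, LinearMap.neg_apply]
    linear_combination (norm := module) -(1 : ℝ) • h
  · intro X Y u v
    have h := form_F1_lie F X Y u v
    simp only [jacobiatorDefect, splitBracketₗ_apply, splitActionₗ_apply, splitTernaryₗ_apply,
      map_zero, LinearMap.zero_apply, add_zero, sub_zero, map_neg, zero_add, Prod.fst_zero, Prod.snd_zero, lie_zero, zero_sub,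
      op0_zero, op1_zero, form_zero, neg_zero, LinearMap.neg_apply]
    linear_combination (norm := module) -(1 : ℝ) • h
  · intro X u v w
    have h := (F.F1 X).op1_l3 u v w
    simp only [jacobiatorDefect, splitBracketₗ_apply, splitActionₗ_apply, splitTernaryₗ_apply,
      map_zero, LinearMap.zero_apply, add_zero, sub_zero, zero_add, Prod.fst_zero, Prod.snd_zero, lie_zero,
      op0_zero, op1_zero, form_zero, neg_zero]
    linear_combination (norm := module) h
  · intro u v w z
    have h := 𝔊.jacobiator u v w z
    simp only [jacobiatorDefect, splitBracketₗ_apply, splitActionₗ_apply, splitTernaryₗ_apply,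
      map_zero, LinearMap.zero_apply, add_zero, sub_zero, zero_add, Prod.fst_zero, Prod.snd_zero, lie_zero,
      op0_zero, op1_zero, form_zero, neg_zero]
    linear_combination (norm := module) h

/-- The Lie 2-algebroid `𝒢_{-1} ⊕ (TM ⊕ 𝒢_0)` assembled from `𝔊` and a morphism
`TM → DER(𝔊)`. -/
noncomputable def splitForm : Lie2Algebroid E M (VF E M × G0) G1 where
  l1 := LinearMap.inr ℝ (VF E M) G0 ∘ₗ 𝔊.l1
  l2 := splitBracketₗ F
  l2' := splitActionₗ F
  l3 := splitTernaryₗ F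
  l2_skew := splitBracket_skew F
  l3_skew_left := splitTernary_skew_left F
  l3_skew_right := splitTernary_skew_right F
  l1_l2' x m := by
    obtain ⟨X, u⟩ := x
    change ((0, 𝔊.l1 ((F.F1 X).op1 m + 𝔊.l2' u m)) : VF E M × G0) =
      (⁅X, 0⁆, -(F.F2 X 0).2 + (F.F1 X).op0 (𝔊.l1 m) - (F.F1 0).op0 u + 𝔊.l2 u (𝔊.l1 m))
    simp only [lie_zero, map_zero, Prod.snd_zero, neg_zero, zero_add, op0_zero, sub_zero, map_add,
      op0_l1, 𝔊.l1_l2']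
  l2'_l1 m n := by
    change (F.F1 0).op1 n + 𝔊.l2' (𝔊.l1 m) n = -((F.F1 0).op1 m + 𝔊.l2' (𝔊.l1 n) m)
    simp only [map_zero, op1_zero, zero_add]
    exact 𝔊.l2'_l1 m n
  jacobi := splitTernary_jacobi F
  jacobi' := splitTernary_l1 F
  jacobiator := splitTernary_jacobiator F
  anchor := LinearMap.fst (Fn E M) (VF E M) G0
  l1_smul f m := Prod.ext (smul_zero f).symm (𝔊.l1_smul f m)
  l2_leibniz := splitBracket_fsmul_right F
  l2'_leibniz x f m := by
    change (F.F1 x.1).op1 (f • m) + 𝔊.l2' x.2 (f • m) =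
      f • ((F.F1 x.1).op1 m + 𝔊.l2' x.2 m) + vfDer x.1 f • m
    rw [op1_smul, symbol_F1, 𝔊.l2'_smul_right]
    module
  l2'_smul f x m := by
    change (F.F1 (f • x.1)).op1 m + 𝔊.l2' (f • x.2) m = f • ((F.F1 x.1).op1 m + 𝔊.l2' x.2 m)
    rw [map_smul, op1_fsmul, 𝔊.l2'_smul_left, smul_add]
  l3_smul := splitTernary_fsmul_right F

theorem isSplitForm_splitForm : 𝔊.IsSplitForm F (splitForm F) where
  anchor _ _ := rfl
  l1 _ := rfl
  l2 _ _ _ _ := rfl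
  l2' _ _ _ := rfl
  l3 _ _ _ _ _ _ := rfl

end Lie2AlgebraBundle
end SplitFormAlgebroid


/-! ### Recovering the Lie 2-algebroid from its morphism. -/

section Classification

variable {E M : Type*} [NormedAddCommGroup E] [NormedSpace ℝ E] [FiniteDimensional ℝ E]
  [TopologicalSpace M] [ChartedSpace E M] [IsManifold 𝓘(ℝ, E) ∞ M]
  {L0 L1 : Type*}
  [AddCommGroup L0] [Module ℝ L0] [Module (Fn E M) L0] [IsScalarTower ℝ (Fn E M) L0]
  [AddCommGroup L1] [Module ℝ L1] [Module (Fn E M) L1] [IsScalarTower ℝ (Fn E M) L1]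

/-- Every tangent vector is a value of a global smooth vector field. -/
theorem exists_vf_apply_eq [T2Space M] (x : M) (v : TangentSpace 𝓘(ℝ, E) x) :
    ∃ X : VF E M, X x = v := by
  obtain ⟨s, hs, hsmooth⟩ := FiberBundle.exists_contMDiffOn_extend (k := ∞) 𝓘(ℝ, E) E v
  -- The bump function is supported inside the open set where the local extension of `v` is smooth,
  -- so the product is globally smooth; it equals 1 at `x`, so the value `v` is kept.
  obtain ⟨b, -, hb⟩ := (SmoothBumpFunction.nhds_basis_tsupport (I := 𝓘(ℝ, E)) x).mem_iff.mp
    (interior_mem_nhds.mpr hs)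
  refine ⟨⟨_, ContMDiffOn.smul_section_of_tsupport b.contMDiff.contMDiffOn isOpen_interior hb
    (hsmooth.mono interior_subset)⟩, ?_⟩
  change b x • FiberBundle.extend E v x = v
  rw [b.eq_one, one_smul, FiberBundle.extend_apply_self]

namespace Lie2Algebroid.Splitting

variable {A : Lie2Algebroid E M L0 L1} (S : A.Splitting)

/-- `(X, u) ↦ σ(X) + u` -/
noncomputable def equiv : (VF E M × A.ker) ≃ₗ[Fn E M] L0 where
  toFun x := S.σ x.1 + x.2
  map_add' x y := by
    simp only [Prod.fst_add, Prod.snd_add, map_add, Submodule.coe_add]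
    abel
  map_smul' f x := by
    simp only [Prod.smul_fst, Prod.smul_snd, map_smul, Submodule.coe_smul, smul_add,
      RingHom.id_apply]
  invFun a := (A.anchor a, ⟨a - S.σ (A.anchor a), by
    rw [LinearMap.mem_ker, map_sub, S.anchor_σ, sub_self]⟩)
  left_inv x := by
    have h : A.anchor (S.σ x.1 + x.2) = x.1 := by
      rw [map_add, S.anchor_σ, LinearMap.mem_ker.mp x.2.2, add_zero]
    refine Prod.ext h (Subtype.ext ?_)
    change S.σ x.1 + (x.2 : L0) - S.σ (A.anchor (S.σ x.1 + x.2)) = x.2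
    rw [h, add_sub_cancel_left]
  right_inv a := by
    change S.σ (A.anchor a) + (a - S.σ (A.anchor a)) = a
    abel

/-- No Jacobi identity enters: the components of F were defined as the values of the brackets of `A`
on σX and u, so expanding on σ(X) + u returns them. For `l2` the vector part works because σ[X,Y] -
R_γ(X,Y) = l_2(σX, σY). -/
theorem isStrictIso_equiv [T2Space M] (hA : A.Transitive) :
    (Lie2AlgebraBundle.splitForm (S.morphism hA)).IsStrictIso A S.equiv
      (LinearEquiv.refl (Fn E M) L1) where
  anchor x := by
    change A.anchor (S.σ x.1 + x.2) = x.1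
    rw [map_add, S.anchor_σ, LinearMap.mem_ker.mp x.2.2, add_zero]
  l1 m := by
    change A.l1 m = S.σ 0 + A.l1 m
    rw [map_zero, zero_add]
  l2 x y := by
    obtain ⟨X, u⟩ := x
    obtain ⟨Y, v⟩ := y
    change A.l2 (S.σ X + u) (S.σ Y + v) =
      S.σ ⁅X, Y⁆ + (-S.Rγ X Y + A.l2 (S.σ X) v - A.l2 (S.σ Y) u + A.l2 u v)
    rw [Rγ_eq, A.l2_skew (S.σ Y) u]
    simp only [map_add, LinearMap.add_apply]
    abel
  l2' x m := by
    change A.l2' (S.σ x.1 + x.2) m = A.l2' (S.σ x.1) m + A.l2' x.2 m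
    rw [map_add, LinearMap.add_apply]
  l3 x y z := by
    obtain ⟨X, u⟩ := x
    obtain ⟨Y, v⟩ := y
    obtain ⟨Z, w⟩ := z
    change A.l3 (S.σ X + u) (S.σ Y + v) (S.σ Z + w) =
      - -A.l3 (S.σ X) (S.σ Y) (S.σ Z) - -A.l3 (S.σ X) (S.σ Y) w + -A.l3 (S.σ X) (S.σ Z) v
        - -A.l3 (S.σ Y) (S.σ Z) u + A.l3 (S.σ X) v w - A.l3 (S.σ Y) u w + A.l3 (S.σ Z) u v
        + A.l3 u v w
    -- The split form lists vector fields first; the expansion of the left side keeps the original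
    -- order of the slots, and skew-symmetry reconciles the two.
    rw [l3_rotate (S.σ Z), A.l3_skew_left (S.σ Y) u, ← l3_rotate (u : L0) (S.σ Y),
      A.l3_skew_right _ (S.σ Z)]
    simp only [map_add, LinearMap.add_apply]
    abel

end Lie2Algebroid.Splitting
end Classification


theorem theorem3
    {E M : Type*} [NormedAddCommGroup E] [NormedSpace ℝ E] [FiniteDimensional ℝ E]
    [TopologicalSpace M] [T2Space M] [ChartedSpace E M] [IsManifold 𝓘(ℝ, E) ∞ M]
    -- the vector bundles `V0` (degree `0`) and `V1` (degree `-1`) over `M`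
    {F0 : Type*} [NormedAddCommGroup F0] [NormedSpace ℝ F0] [FiniteDimensional ℝ F0]
    {V0 : M → Type*} [∀ x, AddCommGroup (V0 x)] [∀ x, Module ℝ (V0 x)]
    [TopologicalSpace (Bundle.TotalSpace F0 V0)] [∀ x, TopologicalSpace (V0 x)]
    [FiberBundle F0 V0] [VectorBundle ℝ F0 V0] [ContMDiffVectorBundle ∞ F0 V0 𝓘(ℝ, E)]
    {F1 : Type*} [NormedAddCommGroup F1] [NormedSpace ℝ F1] [FiniteDimensional ℝ F1]
    {V1 : M → Type*} [∀ x, AddCommGroup (V1 x)] [∀ x, Module ℝ (V1 x)]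
    [TopologicalSpace (Bundle.TotalSpace F1 V1)] [∀ x, TopologicalSpace (V1 x)]
    [FiberBundle F1 V1] [VectorBundle ℝ F1 V1] [ContMDiffVectorBundle ∞ F1 V1 𝓘(ℝ, E)] :
    -- a transitive Lie 2-algebroid `A` with a splitting `S` induces a morphism `TM → DER(𝔊)`,
    -- and this morphism determines `A`
    (∀ (A : Lie2Algebroid E M (Sec E F0 V0) (Sec E F1 V1)) (hA : A.Transitive)
        (S : A.Splitting),
      ∃ F : (tangentLieAlgebroid E M).Morphism (A.kerBundle hA).DER,
        ((∀ X u, ((F.F1 X).op0 u : Sec E F0 V0) = S.nabla0 X u) ∧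
          (∀ X m, (F.F1 X).op1 m = S.nabla1 X m) ∧
          (∀ X u v, (F.F1 X).form u v = S.K X u v) ∧
          (∀ X Y u, (F.F2 X Y).1 u = S.J X Y u) ∧
          (∀ X Y, ((F.F2 X Y).2 : Sec E F0 V0) = S.Rγ X Y) ∧
          (∀ X Y Z, F.F3 X Y Z = S.Iγ X Y Z)) ∧
        ∃ B : Lie2Algebroid E M (VF E M × A.ker) (Sec E F1 V1),
          (A.kerBundle hA).IsSplitForm F B ∧
          ∃ e : (VF E M × A.ker) ≃ₗ[Fn E M] Sec E F0 V0,
            (∀ X u, e (X, u) = S.σ X + u) ∧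
            B.IsStrictIso A e (LinearEquiv.refl (Fn E M) (Sec E F1 V1))) ∧
    -- conversely, every morphism `TM → DER(𝔊)` gives a transitive Lie 2-algebroid
    (∀ (𝔊 : Lie2AlgebraBundle E M (Sec E F0 V0) (Sec E F1 V1))
        (F : (tangentLieAlgebroid E M).Morphism 𝔊.DER),
      ∃ B : Lie2Algebroid E M (VF E M × Sec E F0 V0) (Sec E F1 V1),
        B.Transitive ∧ 𝔊.IsSplitForm F B) := by 
  -- Only the F^3 formula needs a lemma, since F^3 was built as -l_3(σX, σY, σZ) and the d_{∇^1}γ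
  -- terms of I_γ must first cancel.
  refine ⟨fun A hA S => ⟨S.morphism hA, ⟨fun _ _ => rfl, fun _ _ => rfl, fun _ _ _ => rfl,
    fun _ _ _ => rfl, fun _ _ => rfl, fun X Y Z => (S.Iγ_eq X Y Z).symm⟩,
    Lie2AlgebraBundle.splitForm (S.morphism hA), Lie2AlgebraBundle.isSplitForm_splitForm _,
    S.equiv, fun _ _ => rfl, S.isStrictIso_equiv hA⟩, fun 𝔊 F =>
    ⟨Lie2AlgebraBundle.splitForm F, fun x v => ?_, Lie2AlgebraBundle.isSplitForm_splitForm F⟩⟩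
  -- The anchor is the projection to TM, so transitivity asks for a global vector field through each
  -- tangent vector.
  obtain ⟨X, hX⟩ := exists_vf_apply_eq x v
  exact ⟨(X, 0), hX⟩
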